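/- **Theorem (Upper bound rate for $\nu^*(\mathbf X)$).** *Setting.* Let $0<\alpha<\beta<\infty$, let $B\subset\mathbb R^p$ be compact with a probability measure $\mu$, and let $\|f-g\|_2=(\int_B (f-g)^2d\mu)^{1/2}$. Let $\mathcal F$ be a star-shaped class of measurable densities $f:B\to[\alpha,\beta]$, $\int_B f\,d\mu=1$, and $d=\sup_{f,g\in\mathcal F}\|f-g\|_2$. A finite set is an $r$-packing if its distinct points are at distance $>r$; $\mathcal M(r,S)$ is the supremum of the cardinalities of $r$-packings of $S$; with closed $L_2$ balls $B_2$, $\mathcal M^{\rm loc}_{\mathcal F}(\tau,c)=\sup_{f\in\mathcal F}\mathcal M(\tau/c,\mathcal F\cap B_2(f,\tau))$. *Constants.* Let $h(\gamma)=\frac{\gamma-1-\log\gamma}{(\gamma-1)^2}$ ($h(1)=\frac12$), $c(\alpha,\beta)=h(\beta/\alpha)/\beta$, $K(\alpha,\beta)=\beta/(\alpha^2c(\alpha,\beta))$, $C>1+\sqrt{1/(\alpha c(\alpha,\beta))}$, $c=2(C+1)$, $\phi\in(1,\frac32)$, $$L(\alpha,\beta,C)=\frac{\{\sqrt{c(\alpha,\beta)}(C-1)-\sqrt{1/\alpha}\}^2}{2(2K(\alpha,\beta)+\frac23\log(\beta/\alpha))},\qquad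 C_{10}=\frac{L(\alpha,\beta,C)}4\Big(\frac12-\frac\phi3\Big),\qquad \tau_J=\frac{\sqrt{C_{10}}\,d}{2^{J-1}(C+1)}\quad(J\ge1).$$ Let $\bar J$ be the maximal integer $J\ge1$ with $N\tau_J^2>2\log\big[\mathcal M^{\rm loc}_{\mathcal F}(\tau_J c/\sqrt{C_{10}},2c)\big]^2\vee\log 2$ (the right side is $+\infty$ if the packing number is infinite), or $\bar J=1$ if no such $J$ exists. *Data.* Let $0\le\epsilon\le\frac13$, let $\tilde X_1,\dots,\tilde X_N$ be i.i.d. with density $f\in\mathcal F$, and let $\mathbf X=(X_1,\dots,X_N)$ be obtained by an arbitrary (possibly adaptive and randomized) corruption with $X_i\ne\tilde X_i$ for at most $\epsilon N$ indices. Let $m=\max\{3\epsilon N,1\}$, assumed to be an integer, and split $\{1,\dots,N\}$ into $m$ groups $G_1,\dots,G_m$ of sizes $\lfloor N/m\rfloor$ or $\lfloor N/m\rfloor+1$. Write $g'\prec g$ if $\sum_{i\in G_j}\log\frac{g(X_i)}{g'(X_i)}>0$ for at least $m/2$ of the groups. *Pruned tree (built without the data).* Level 1 is a root $\nu_1\in\mathcal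 F$. The offspring of $\nu_1$ at level 2 form a maximal $d/c$-packing of $\mathcal F$. For $j\ge3$, take for each node $q$ of level $j-1$ a maximal $d/(2^{j-1}c)$-packing $U_q$ of $B_2(q,d/2^{j-2})\cap\mathcal F$; list all these candidates in some order; repeatedly take the first remaining candidate, keep it, let it absorb all other remaining candidates within distance $d/(2^{j-1}c)$, and remove it and these from the list. The offspring of $q$ are the kept candidates that belong to $U_q$ or absorbed an element of $U_q$; level $j$ consists of all the offspring of the nodes of level $j-1$. *Estimator.* For $j\ge2$, with $\delta_j=d/(2^{j-2}c)$ and $S$ the set of offspring of $\nu_{j-1}$, let $\nu_j$ be a minimizer over $\nu\in S$ of $$T_\nu=\max\{\|\nu-\nu'\|_2:\ \nu'\in S,\ \nu\prec\nu',\ \|\nu-\nu'\|_2\ge C\delta_j\}\qquad(\max\emptyset=0),$$ ties being broken by any measurable rule. Fix $\tilde J\ge\bar J$, build the tree down to level $\tilde J$, and let $\nu^*=\nu_{\tilde J}$. *Claim.* There is a constant $A>0$ depending only on $\alpha,\beta,C,\phi$ such that, for all $p,B,\mu,\mathcal F,N,\epsilon$, all groups, all $\tilde J\ge\bar J$, all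 choices in the construction of the tree and in the breaking of ties, all $f\in\mathcal F$ and all corruptions, $$\mathbb E_f\|\nu^*(\mathbf X)-f\|_2^2\le A\,\big(\max\{\tau_{\bar J}^2,\epsilon\}\wedge d^2\big).$$ -/

import Mathlib

open MeasureTheory ProbabilityTheory
open scoped ENNReal

noncomputable section

namespace RobustSieve

/-! ### Density classes, the `L₂` distance, packing numbers and local entropy -/

/-- The ambient class of measurable densities (with respect to `μ`) with values in `[α, β]`. -/
def ambientClass {𝒳 : Type*} [MeasurableSpace 𝒳] (μ : Measure 𝒳) (α β : ℝ) : Set (𝒳 → ℝ) :=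
  {f | Measurable f ∧ (∀ x, f x ∈ Set.Icc α β) ∧ ∫ x, f x ∂μ = 1}

/-- `‖f - g‖₂ = (∫ (f - g)² dμ)^{1/2}`. -/
def dist2 {𝒳 : Type*} [MeasurableSpace 𝒳] (μ : Measure 𝒳) (f g : 𝒳 → ℝ) : ℝ :=
  Real.sqrt (∫ x, (f x - g x) ^ 2 ∂μ)

/-- The closed `L₂` ball. -/
def ball2 {𝒳 : Type*} [MeasurableSpace 𝒳] (μ : Measure 𝒳) (f : 𝒳 → ℝ) (r : ℝ) : Set (𝒳 → ℝ) :=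
  {g | dist2 μ f g ≤ r}

/-- The `L₂` diameter (the distances are bounded by `β - α` on a subclass of `ambientClass`). -/
def diam2 {𝒳 : Type*} [MeasurableSpace 𝒳] (μ : Measure 𝒳) (F : Set (𝒳 → ℝ)) : ℝ :=
  sSup {r | ∃ f ∈ F, ∃ g ∈ F, r = dist2 μ f g}

/-- `P` is a (finite) `r`-packing set of `S`: its points lie in `S` and are `r`-separated. -/
def IsPacking {𝒳 : Type*} [MeasurableSpace 𝒳] (μ : Measure 𝒳) (r : ℝ) (S : Set (𝒳 → ℝ))
    (P : Finset (𝒳 → ℝ)) : Prop :=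
  (P : Set (𝒳 → ℝ)) ⊆ S ∧ (P : Set (𝒳 → ℝ)).Pairwise (fun f g => r < dist2 μ f g)

/-- The `r`-packing number, with value `⊤` if there are arbitrarily large `r`-packing sets. -/
def packingNumber {𝒳 : Type*} [MeasurableSpace 𝒳] (μ : Measure 𝒳) (r : ℝ)
    (S : Set (𝒳 → ℝ)) : ℕ∞ :=
  ⨆ (P : Finset (𝒳 → ℝ)) (_ : IsPacking μ r S P), (P.card : ℕ∞)

/-- `M^loc_F(τ, c) = sup_{f ∈ F} M(τ / c, F ∩ B₂(f, τ))`. -/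
def localPacking {𝒳 : Type*} [MeasurableSpace 𝒳] (μ : Measure 𝒳) (F : Set (𝒳 → ℝ))
    (τ c : ℝ) : ℕ∞ :=
  ⨆ f ∈ F, packingNumber μ (τ / c) (F ∩ ball2 μ f τ)

/-! ### The numerical constants -/

/-- `h(γ) = (γ - 1 - log γ) / (γ - 1)²`, extended by continuity at `γ = 1`. -/
def hFun (γ : ℝ) : ℝ :=
  if γ = 1 then 1 / 2 else (γ - 1 - Real.log γ) / (γ - 1) ^ 2

/-- `c(α, β) = h(β / α) / β`. -/
def cKL (α β : ℝ) : ℝ := hFun (β / α) / β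

/-- `K(α, β) = β / (α² c(α, β))`. -/
def KConst (α β : ℝ) : ℝ := β / (α ^ 2 * cKL α β)

/-- `L(α, β, C)`. -/
def LConst (α β C : ℝ) : ℝ :=
  (Real.sqrt (cKL α β) * (C - 1) - Real.sqrt (1 / α)) ^ 2 /
    (2 * (2 * KConst α β + 2 / 3 * Real.log (β / α)))

/-- `C₁₀ = (L(α, β, C) / 4) (1/2 - φ/3)`. -/
def C10 (α β C φ : ℝ) : ℝ := LConst α β C / 4 * (1 / 2 - φ / 3)

/-- `τ_J = √C₁₀ d / (2^{J-1} (C + 1))`, used for `J ≥ 1`. -/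
def tau (α β C φ d : ℝ) (J : ℕ) : ℝ :=
  Real.sqrt (C10 α β C φ) * d / (2 ^ (J - 1) * (C + 1))

/-- `N τ_J² > 2 log [M^loc_F(τ_J c / √C₁₀, 2c)]² ∨ log 2` with `c = 2 (C + 1)`. It is an inequality
of extended reals, and it fails if the local packing number is infinite. -/
def EntropyCondition {𝒳 : Type*} [MeasurableSpace 𝒳] (μ : Measure 𝒳) (F : Set (𝒳 → ℝ))
    (α β C φ : ℝ) (N J : ℕ) : Prop :=
  max (2 * ENNReal.log
        ((localPacking μ F
            (tau α β C φ (diam2 μ F) J * (2 * (C + 1)) / Real.sqrt (C10 α β C φ))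
            (2 * (2 * (C + 1))) : ℝ≥0∞) ^ 2))
      ((Real.log 2 : ℝ) : EReal)
    < (((N : ℝ) * tau α β C φ (diam2 μ F) J ^ 2 : ℝ) : EReal)

/-- `Jbar` is the maximal integer `J ≥ 1` with the entropy condition, and `1` if there is none. -/
def IsJbar {𝒳 : Type*} [MeasurableSpace 𝒳] (μ : Measure 𝒳) (F : Set (𝒳 → ℝ))
    (α β C φ : ℝ) (N Jbar : ℕ) : Prop :=
  IsGreatest {J : ℕ | 1 ≤ J ∧ EntropyCondition μ F α β C φ N J} Jbar ∨
    ((∀ J : ℕ, 1 ≤ J → ¬ EntropyCondition μ F α β C φ N J) ∧ Jbar = 1)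

/-! ### The group-majority log-likelihood comparison -/

/-- The groups `G₁, …, G_m` (the fibres of `G`) have sizes `⌊N/m⌋` or `⌊N/m⌋ + 1`; if `m ∣ N` then
all of them have size `N / m`. -/
def IsBalanced {N m : ℕ} (G : Fin N → Fin m) : Prop :=
  ∀ j : Fin m, N / m ≤ (Finset.univ.filter (fun i => G i = j)).card ∧
    (Finset.univ.filter (fun i => G i = j)).card ≤ N / m + 1

/-- `ψ(g, g', x) = 1`, that is `g' ≺ g`: in at least half of the `m` groups the log-likelihood
difference between `g` and `g'` is positive. -/
def Beats {𝒳 : Type*} {N m : ℕ} (G : Fin N → Fin m) (x : Fin N → 𝒳) (g g' : 𝒳 → ℝ) : Prop :=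
  (m : ℝ) / 2 ≤ (({j : Fin m | 0 < ∑ i with G i = j, Real.log (g (x i) / g' (x i))} :
    Set (Fin m)).ncard : ℝ)

open Classical in
/-- `E_ν`: the densities `ν' ∈ S` with `ν ≺ ν'` and `‖ν - ν'‖₂ ≥ C δ`. -/
def betterFar {𝒳 : Type*} [MeasurableSpace 𝒳] (μ : Measure 𝒳) {N m : ℕ} (G : Fin N → Fin m)
    (C δ : ℝ) (S : Finset (𝒳 → ℝ)) (x : Fin N → 𝒳) (ν : 𝒳 → ℝ) : Finset (𝒳 → ℝ) :=
  S.filter (fun ν' => Beats G x ν' ν ∧ C * δ ≤ dist2 μ ν ν')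

open Classical in
/-- `T_ν`: the maximum of `‖ν - ν'‖₂` over `ν' ∈ E_ν`, and `0` if `E_ν` is empty. -/
def score {𝒳 : Type*} [MeasurableSpace 𝒳] (μ : Measure 𝒳) {N m : ℕ} (G : Fin N → Fin m)
    (C δ : ℝ) (S : Finset (𝒳 → ℝ)) (x : Fin N → 𝒳) (ν : 𝒳 → ℝ) : ℝ :=
  if h : (betterFar μ G C δ S x ν).Nonempty then
    (betterFar μ G C δ S x ν).sup' h (fun ν' => dist2 μ ν ν')
  else 0

open Classical in
/-- `argmin_{ν ∈ S} T_ν`. -/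
def bestSet {𝒳 : Type*} [MeasurableSpace 𝒳] (μ : Measure 𝒳) {N m : ℕ} (G : Fin N → Fin m)
    (C δ : ℝ) (S : Finset (𝒳 → ℝ)) (x : Fin N → 𝒳) : Finset (𝒳 → ℝ) :=
  S.filter (fun ν => ∀ ν' ∈ S, score μ G C δ S x ν ≤ score μ G C δ S x ν')

/-! ### The pruned tree -/

/-- The choices made when the tree is built: the root, the packing set `pack j q` constructed at
level `j` for the node `q` of level `j - 1`, and the order `order j` of all the candidates at
level `j`. -/
structure TreeChoices (𝒳 : Type*) where
  root : 𝒳 → ℝ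
  pack : ℕ → (𝒳 → ℝ) → Finset (𝒳 → ℝ)
  order : ℕ → List (𝒳 → ℝ)

/-- Separation of the packing sets at level `j`: `d / c` for `j = 2`, `d / (2^{j-1} c)` for
`j ≥ 3`. -/
def packRadius (d c : ℝ) (j : ℕ) : ℝ := if j = 2 then d / c else d / (2 ^ (j - 1) * c)

/-- Radius `d / 2^{j-2}` of the balls packed at level `j ≥ 2`. -/
def ballRadius (d : ℝ) (j : ℕ) : ℝ := d / 2 ^ (j - 2)

open Classical in
/-- The pruning loop. It takes the first element `q` of the list, absorbs into it all the other
elements at distance `≤ r`, removes `q` and these from the list, and goes on. The result lists the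
surviving points `q`, each with `q` and the points that it absorbed. -/
def clusters {𝒳 : Type*} [MeasurableSpace 𝒳] (μ : Measure 𝒳) (r : ℝ) :
    List (𝒳 → ℝ) → List ((𝒳 → ℝ) × List (𝒳 → ℝ))
  | [] => []
  | q :: Q =>
      (q, q :: Q.filter (fun u => dist2 μ q u ≤ r)) ::
        clusters μ r (Q.filter (fun u => ¬ dist2 μ q u ≤ r))
  termination_by Q => Q.length
  decreasing_by
    simp only [List.length_unattach, List.length_cons]
    exact Nat.lt_succ_of_le ((List.length_filter_le _ _).trans (by simp))

open Classical in
/-- The offspring at level `j` of a node `q` of level `j - 1`. At level `2` there is no pruning. At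
level `j ≥ 3` an edge from `q` to a candidate is redirected to the surviving point that absorbed
this candidate. -/
def offspring {𝒳 : Type*} [MeasurableSpace 𝒳] (μ : Measure 𝒳) (d c : ℝ) (T : TreeChoices 𝒳)
    (j : ℕ) (q : 𝒳 → ℝ) : Finset (𝒳 → ℝ) :=
  if j ≤ 2 then T.pack j q
  else
    (((clusters μ (packRadius d c j) (T.order j)).filter
      (fun s => ∃ u ∈ s.2, u ∈ T.pack j q)).map Prod.fst).toFinset

open Classical in
/-- The levels of the pruned tree; the root forms level `1`. -/
def level {𝒳 : Type*} [MeasurableSpace 𝒳] (μ : Measure 𝒳) (d c : ℝ) (T : TreeChoices 𝒳) :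
    ℕ → Finset (𝒳 → ℝ)
  | 0 => ∅
  | 1 => {T.root}
  | j + 2 => (level μ d c T (j + 1)).biUnion (offspring μ d c T (j + 2))

/-- The choices are those of a run of the tree construction for the class `F` down to level `Jt`:
the root lies in `F`, every `pack j q` is a maximal packing set of `B₂(q, d / 2^{j-2}) ∩ F`, and
`order j` enumerates the candidates at level `j`. -/
def IsPrunedTree {𝒳 : Type*} [MeasurableSpace 𝒳] (μ : Measure 𝒳) (F : Set (𝒳 → ℝ)) (c : ℝ)
    (Jt : ℕ) (T : TreeChoices 𝒳) : Prop :=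
  T.root ∈ F ∧
  ∀ j : ℕ, 2 ≤ j → j ≤ Jt →
    (∀ q ∈ level μ (diam2 μ F) c T (j - 1),
      Maximal (IsPacking μ (packRadius (diam2 μ F) c j)
        (ball2 μ q (ballRadius (diam2 μ F) j) ∩ F)) (T.pack j q)) ∧
    (3 ≤ j → (T.order j).Nodup ∧
      ∀ u, u ∈ T.order j ↔ ∃ q ∈ level μ (diam2 μ F) c T (j - 1), u ∈ T.pack j q)

/-! ### The estimator -/

/-- A rule that picks an element of every nonempty finite set, used to break ties in the argmin. It
may depend on the data, in a measurable way. -/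
def IsTieBreak {𝒳 : Type*} [MeasurableSpace 𝒳] {N : ℕ}
    (pick : (Fin N → 𝒳) → Finset (𝒳 → ℝ) → (𝒳 → ℝ)) : Prop :=
  (∀ x S, S.Nonempty → pick x S ∈ S) ∧ ∀ S q, MeasurableSet {x | pick x S = q}

/-- The node `ν_j(x)` of level `j ≥ 1` reached on the data `x`: `ν₁` is the root, and `ν_j` is the
best offspring of `ν_{j-1}`, by the criterion with `δ = d / (2^{j-2} c)`, `c = 2 (C + 1)`.
The estimator is `ν_J` for the last level `J`. -/
def sieve {𝒳 : Type*} [MeasurableSpace 𝒳] (μ : Measure 𝒳) (d C : ℝ) (T : TreeChoices 𝒳)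
    {N m : ℕ} (G : Fin N → Fin m) (pick : (Fin N → 𝒳) → Finset (𝒳 → ℝ) → (𝒳 → ℝ))
    (x : Fin N → 𝒳) : ℕ → (𝒳 → ℝ)
  | 0 => T.root
  | 1 => T.root
  | j + 2 => pick x (bestSet μ G C (d / (2 ^ j * (2 * (C + 1))))
      (offspring μ d (2 * (C + 1)) T (j + 2) (sieve μ d C T G pick x (j + 1))) x)

/-! ### The corrupted sample -/

/-- `Xt` is an i.i.d. sample from the density `f`, and `X` is obtained from it by an arbitrary
(possibly adaptive and randomized) corruption of at most a fraction `ε` of the observations. -/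
def IsCorruptedSample {𝒳 : Type*} [MeasurableSpace 𝒳] (μ : Measure 𝒳) (f : 𝒳 → ℝ) (ε : ℝ)
    {Ω : Type*} [MeasurableSpace Ω] (P : Measure Ω) {N : ℕ} (Xt X : Fin N → Ω → 𝒳) : Prop :=
  (∀ i, Measurable (Xt i)) ∧ iIndepFun Xt P ∧
  (∀ i, P.map (Xt i) = μ.withDensity (fun x => ENNReal.ofReal (f x))) ∧
  (∀ i, Measurable (X i)) ∧
  ∀ᵐ ω ∂P, (({i : Fin N | X i ω ≠ Xt i ω} : Set (Fin N)).ncard : ℝ) ≤ ε * N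

end RobustSieve

end

open RobustSieve

namespace RobustSieve

/-! ### The `L₂` distance as a norm -/

section Analysis

variable {𝒳 : Type*} [MeasurableSpace 𝒳] {μ : Measure 𝒳} {α β : ℝ}

/-! The tree is fixed before the data are seen, and the invariant is that the node reached at level
`k + 1` lies within `d / 2 ^ k` of `f`. Suppose it does. Some offspring `g₀` of this node lies
within `δ = d / (2 ^ k * c)` of `f`: maximal packings cover, and pruning costs only one further
packing radius. If `g₀` wins its comparison against every offspring at distance at least `C * δ`,
its score is `0` while each of those has a positive score, so the minimizer is within `C * δ` of
`g₀`. As `(C + 1) * δ = d / 2 ^ (k + 1)`, the invariant passes to the next level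
(`dist2_lt_of_mem_bestSet`, `IsPrunedTree.exists_bad_event`).

One such comparison fails with probability at most `2 ^ m * exp (-N L δ² / 12)`. Densities in `[α,
β]` have Kullback--Leibler divergence comparable to the squared `L₂` distance, which controls the
mean and the second moment of a log-likelihood ratio and gives the Chernoff bound
`exists_integral_mul_exp_le`. A failure needs `m / 2` groups of the wrong sign. Corruption reaches
at most `ε N ≤ m / 3` groups, so `m / 6` groups are wrong already on the clean sample. Such groups
hold at least `N / 12` observations, and there are at most `2 ^ m` sets of groups.

The union bound runs over the nodes near `f` and their offspring. Both counts are at most a local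
packing number `M`: pruning keeps each level separated, and the offspring of a node inject into its
packing set. The entropy condition at `Jbar`, carried to coarser scales by `localPacking_anti`, lets
the exponential absorb `M ^ 2`; it absorbs `2 ^ m` as long as `ε` is at most a small multiple of `δ
^ 2`.

Below a given level the path moves only by a geometric series. Leaving the invariant at scale `k`
thus costs a multiple of `(d / 2 ^ k) ^ 2` on an event of probability at most `2 exp (-a N (d / 2 ^
k) ^ 2)`, and the sum over `k` is dominated by the finest scale. The analysis stops at the finest
scale, not below that of `Jbar`, whose square still dominates `ε`: either this is the scale of
`Jbar`, or its square is comparable to `ε`. -/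

theorem dist2_nonneg (f g : 𝒳 → ℝ) : 0 ≤ dist2 μ f g := Real.sqrt_nonneg _

theorem dist2_comm (f g : 𝒳 → ℝ) : dist2 μ f g = dist2 μ g f := by
  unfold dist2
  congr 2
  ext x
  ring

theorem dist2_self (f : 𝒳 → ℝ) : dist2 μ f f = 0 := by simp [dist2]

theorem sq_dist2 (f g : 𝒳 → ℝ) : dist2 μ f g ^ 2 = ∫ x, (f x - g x) ^ 2 ∂μ :=
  Real.sq_sqrt (integral_nonneg fun _ => sq_nonneg _)

/-- Source of the triangle inequality, which needs square integrability because the Bochner integral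
of a non-integrable function is `0`. -/
theorem dist2_eq_norm_toLp {f g : 𝒳 → ℝ} (hf : MemLp f 2 μ) (hg : MemLp g 2 μ) :
    dist2 μ f g = ‖hf.toLp f - hg.toLp g‖ := by
  have h : ‖hf.toLp f - hg.toLp g‖ ^ 2 = ∫ x, (f x - g x) ^ 2 ∂μ := by
    rw [← real_inner_self_eq_norm_sq, L2.inner_def]
    refine integral_congr_ae ?_
    filter_upwards [Lp.coeFn_sub (hf.toLp f) (hg.toLp g), hf.coeFn_toLp, hg.coeFn_toLp]
      with x h1 h2 h3
    rw [h1, Pi.sub_apply, h2, h3]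
    simp [sq]
  rw [dist2, ← h, Real.sqrt_sq (norm_nonneg _)]

theorem dist2_triangle {f g h : 𝒳 → ℝ} (hf : MemLp f 2 μ) (hg : MemLp g 2 μ)
    (hh : MemLp h 2 μ) : dist2 μ f h ≤ dist2 μ f g + dist2 μ g h := by
  rw [dist2_eq_norm_toLp hf hg, dist2_eq_norm_toLp hg hh, dist2_eq_norm_toLp hf hh]
  exact norm_sub_le_norm_sub_add_norm_sub _ _ _

theorem memLp_of_mem_ambientClass [IsFiniteMeasure μ] {f : 𝒳 → ℝ} (hf : f ∈ ambientClass μ α β)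
    (p : ℝ≥0∞) : MemLp f p μ :=
  MemLp.of_bound hf.1.aestronglyMeasurable (max |α| |β|) <| Filter.Eventually.of_forall fun x =>
    abs_le_max_abs_abs (hf.2.1 x).1 (hf.2.1 x).2

variable [IsProbabilityMeasure μ]

theorem dist2_le_sub_of_mem {f g : 𝒳 → ℝ} (hf : f ∈ ambientClass μ α β)
    (hg : g ∈ ambientClass μ α β) : dist2 μ f g ≤ |β - α| := by
  rw [dist2, ← Real.sqrt_sq_eq_abs]
  refine Real.sqrt_le_sqrt ?_
  have h : ∫ x, (f x - g x) ^ 2 ∂μ ≤ ∫ _, (β - α) ^ 2 ∂μ := by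
    refine integral_mono_of_nonneg (Filter.Eventually.of_forall fun x => sq_nonneg _)
      (integrable_const _) (Filter.Eventually.of_forall fun x => ?_)
    have h1 := hf.2.1 x
    have h2 := hg.2.1 x
    exact sq_le_sq' (by linarith [h1.1, h2.2]) (by linarith [h1.2, h2.1])
  simpa using h

theorem dist2_le_diam2 {F : Set (𝒳 → ℝ)} (hF : F ⊆ ambientClass μ α β) {f g : 𝒳 → ℝ}
    (hf : f ∈ F) (hg : g ∈ F) : dist2 μ f g ≤ diam2 μ F := by
  refine le_csSup ⟨|β - α|, ?_⟩ ⟨f, hf, g, hg, rfl⟩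
  rintro r ⟨f, hf, g, hg, rfl⟩
  exact dist2_le_sub_of_mem (hF hf) (hF hg)

theorem dist2_triangle_of_mem {f g h : 𝒳 → ℝ} (hf : f ∈ ambientClass μ α β)
    (hg : g ∈ ambientClass μ α β) (hh : h ∈ ambientClass μ α β) :
    dist2 μ f h ≤ dist2 μ f g + dist2 μ g h :=
  dist2_triangle (memLp_of_mem_ambientClass hf 2) (memLp_of_mem_ambientClass hg 2)
    (memLp_of_mem_ambientClass hh 2)

end Analysis

/-! ### The function `h` and the positivity of the constants -/

section Constants

theorem one_add_mul_sub_one_pos {x t : ℝ} (hx : 0 < x) (ht : t ∈ Set.Icc (0 : ℝ) 1) :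
    0 < 1 + t * (x - 1) := by
  rcases ht.2.lt_or_eq with h | h
  · nlinarith [mul_nonneg ht.1 hx.le]
  · rw [h]; linarith

theorem continuousOn_div_one_add {x : ℝ} (hx : 0 < x) :
    ContinuousOn (fun t : ℝ => t / (1 + t * (x - 1))) (Set.Icc 0 1) :=
  ContinuousOn.div (by fun_prop) (by fun_prop) fun _ ht => (one_add_mul_sub_one_pos hx ht).ne'

/-- An explicit antiderivative. The integrand on the right decreases in `x`, which makes the
monotonicity of `h` visible without differentiating a quotient. -/
theorem sub_one_sub_log_eq_integral {x : ℝ} (hx : 0 < x) :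
    x - 1 - Real.log x = (x - 1) ^ 2 * ∫ t in (0 : ℝ)..1, t / (1 + t * (x - 1)) := by
  have hI : Set.uIcc (0 : ℝ) 1 = Set.Icc 0 1 := Set.uIcc_of_le zero_le_one
  rw [← intervalIntegral.integral_const_mul]
  rw [intervalIntegral.integral_eq_sub_of_hasDerivAt
    (f := fun t : ℝ => t * (x - 1) - Real.log (1 + t * (x - 1)))]
  · simp
  · intro t ht
    rw [hI] at ht
    have hp := one_add_mul_sub_one_pos hx ht
    have h1 : HasDerivAt (fun t : ℝ => t * (x - 1)) (x - 1) t := by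
      simpa using (hasDerivAt_id t).mul_const (x - 1)
    have h2 := h1.sub ((h1.const_add 1).log hp.ne')
    refine h2.congr_deriv ?_
    rw [← mul_div_assoc, eq_div_iff hp.ne', sub_mul, div_mul_cancel₀ _ hp.ne']
    ring
  · refine ContinuousOn.intervalIntegrable ?_
    rw [hI]
    exact continuousOn_const.mul (continuousOn_div_one_add hx)

theorem hFun_eq_integral {γ : ℝ} (hγ : 1 < γ) :
    hFun γ = ∫ t in (0 : ℝ)..1, t / (1 + t * (γ - 1)) := by
  have h : (γ - 1) ^ 2 ≠ 0 := pow_ne_zero _ (by linarith)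
  rw [hFun, if_neg hγ.ne', sub_one_sub_log_eq_integral (by linarith), mul_div_cancel_left₀ _ h]

theorem hFun_mul_sq_le {γ x : ℝ} (hγ : 1 < γ) (hx : 0 < x) (hxγ : x ≤ γ) :
    hFun γ * (x - 1) ^ 2 ≤ x - 1 - Real.log x := by
  have hI : Set.uIcc (0 : ℝ) 1 = Set.Icc 0 1 := Set.uIcc_of_le zero_le_one
  have hγ0 : 0 < γ := by linarith
  rw [sub_one_sub_log_eq_integral hx, hFun_eq_integral hγ, mul_comm]
  refine mul_le_mul_of_nonneg_left ?_ (sq_nonneg _)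
  refine intervalIntegral.integral_mono_on zero_le_one
    (ContinuousOn.intervalIntegrable (hI ▸ continuousOn_div_one_add hγ0))
    (ContinuousOn.intervalIntegrable (hI ▸ continuousOn_div_one_add hx)) fun t ht => ?_
  have h1 := one_add_mul_sub_one_pos hx ht
  have := ht.1
  gcongr

theorem hFun_pos {γ : ℝ} (hγ : 1 < γ) : 0 < hFun γ := by
  rw [hFun, if_neg hγ.ne']
  have h := Real.log_lt_sub_one_of_pos (by linarith : 0 < γ) hγ.ne'
  exact div_pos (by linarith) (pow_pos (by linarith) 2)

theorem hFun_le_one {γ : ℝ} (hγ : 1 < γ) : hFun γ ≤ 1 := by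
  rw [hFun, if_neg hγ.ne', div_le_one (pow_pos (by linarith) 2)]
  have h := Real.one_sub_inv_le_log_of_pos (by linarith : 0 < γ)
  have h2 : γ - 1 - (1 - γ⁻¹) = (γ - 1) ^ 2 * γ⁻¹ := by
    field_simp
  have h3 : γ⁻¹ ≤ 1 := inv_le_one_of_one_le₀ hγ.le
  nlinarith [sq_nonneg (γ - 1)]

variable {α β : ℝ}

theorem cKL_pos (hα : 0 < α) (hαβ : α < β) : 0 < cKL α β :=
  div_pos (hFun_pos ((one_lt_div hα).2 hαβ)) (hα.trans hαβ)

theorem KConst_pos (hα : 0 < α) (hαβ : α < β) : 0 < KConst α β :=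
  div_pos (hα.trans hαβ) (mul_pos (pow_pos hα 2) (cKL_pos hα hαβ))

theorem log_ratio_pos (hα : 0 < α) (hαβ : α < β) : 0 < Real.log (β / α) :=
  Real.log_pos ((one_lt_div hα).2 hαβ)

/-- With `γ = β / α`, the constant is `γ ^ 2 / h γ` and `h γ ≤ 1`. This keeps the exponential tilt
in the Chernoff bound small enough for a quadratic expansion. -/
theorem log_ratio_le_KConst (hα : 0 < α) (hαβ : α < β) : Real.log (β / α) ≤ KConst α β := by
  have hβ : 0 < β := hα.trans hαβ
  have hγ : 1 < β / α := (one_lt_div hα).2 hαβ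
  have h1 : KConst α β = (β / α) ^ 2 / hFun (β / α) := by
    have := hFun_pos hγ
    unfold KConst cKL
    field_simp
  have h2 : (β / α) ^ 2 ≤ KConst α β := by
    rw [h1]
    exact le_div_self (by positivity) (hFun_pos hγ) (hFun_le_one hγ)
  have h3 := Real.log_le_sub_one_of_pos (by linarith : 0 < β / α)
  nlinarith

theorem sqrt_cKL_mul_sub_pos (hα : 0 < α) (hαβ : α < β) {C : ℝ}
    (hC : 1 + Real.sqrt (1 / (α * cKL α β)) < C) :
    0 < Real.sqrt (cKL α β) * (C - 1) - Real.sqrt (1 / α) := by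
  have hc := cKL_pos hα hαβ
  have h : Real.sqrt (1 / α) = Real.sqrt (cKL α β) * Real.sqrt (1 / (α * cKL α β)) := by
    rw [← Real.sqrt_mul hc.le]
    congr 1
    field_simp
  rw [h, ← mul_sub]
  exact mul_pos (Real.sqrt_pos.2 hc) (by linarith)

theorem LConst_pos (hα : 0 < α) (hαβ : α < β) {C : ℝ}
    (hC : 1 + Real.sqrt (1 / (α * cKL α β)) < C) : 0 < LConst α β C := by
  have h1 := sqrt_cKL_mul_sub_pos hα hαβ hC
  have h2 := KConst_pos hα hαβ
  have h3 := log_ratio_pos hα hαβ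
  unfold LConst
  positivity

theorem C10_pos (hα : 0 < α) (hαβ : α < β) {C φ : ℝ}
    (hC : 1 + Real.sqrt (1 / (α * cKL α β)) < C) (hφ : φ < 3 / 2) : 0 < C10 α β C φ :=
  mul_pos (div_pos (LConst_pos hα hαβ hC) (by norm_num)) (by linarith)

/-- From `φ > 1` one gets `1 / 2 - φ / 3 < 1 / 6`. This is what lets the exponent of a comparison
absorb the entropy. -/
theorem C10_le (hα : 0 < α) (hαβ : α < β) {C φ : ℝ}
    (hC : 1 + Real.sqrt (1 / (α * cKL α β)) < C) (hφ : 1 < φ) :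
    C10 α β C φ ≤ LConst α β C / 24 := by
  have := LConst_pos hα hαβ hC
  unfold C10
  nlinarith

end Constants

/-! ### Kullback--Leibler divergence and the Chernoff bound -/

section Divergence

variable {𝒳 : Type*} [MeasurableSpace 𝒳] {μ : Measure 𝒳} [IsProbabilityMeasure μ] {α β : ℝ}

theorem integrable_of_mem_ambientClass {f : 𝒳 → ℝ} (hf : f ∈ ambientClass μ α β) :
    Integrable f μ :=
  memLp_one_iff_integrable.1 (memLp_of_mem_ambientClass hf 1)

theorem log_div_le_log_div (hα : 0 < α) {a b : ℝ} (ha : a ∈ Set.Icc α β) (hb : b ∈ Set.Icc α β) :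
    Real.log (a / b) ≤ Real.log (β / α) := by
  have ha0 : 0 < a := hα.trans_le ha.1
  have hb0 : 0 < b := hα.trans_le hb.1
  exact Real.log_le_log (div_pos ha0 hb0) (div_le_div₀ (ha0.le.trans ha.2) ha.2 hα hb.1)

theorem log_div_comm (a b : ℝ) : Real.log (a / b) = -Real.log (b / a) := by
  rw [← Real.log_inv, inv_div]

theorem abs_log_div_le (hα : 0 < α) {a b : ℝ} (ha : a ∈ Set.Icc α β) (hb : b ∈ Set.Icc α β) :
    |Real.log (a / b)| ≤ Real.log (β / α) := by
  refine abs_le.2 ⟨?_, log_div_le_log_div hα ha hb⟩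
  rw [log_div_comm a, neg_le_neg_iff]
  exact log_div_le_log_div hα hb ha

theorem log_div_sq_le (hα : 0 < α) {a b : ℝ} (ha : α ≤ a) (hb : α ≤ b) :
    Real.log (a / b) ^ 2 ≤ (a - b) ^ 2 / α ^ 2 := by
  have key : ∀ {a b : ℝ}, α ≤ a → α ≤ b → Real.log (a / b) ≤ |a - b| / α := by
    intro a b ha hb
    have ha0 : 0 < a := hα.trans_le ha
    have hb0 : 0 < b := hα.trans_le hb
    calc Real.log (a / b) ≤ a / b - 1 := Real.log_le_sub_one_of_pos (div_pos ha0 hb0)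
      _ = (a - b) / b := by field_simp
      _ ≤ |a - b| / b := by gcongr; exact le_abs_self _
      _ ≤ |a - b| / α := by gcongr
  rw [← sq_abs (a - b), ← div_pow, sq_le_sq]
  refine (abs_le.2 ⟨?_, key ha hb⟩).trans (le_abs_self _)
  rw [log_div_comm, neg_le_neg_iff, abs_sub_comm]
  exact key hb ha

/-- The Kullback--Leibler divergence of densities. -/
noncomputable def klDensity (μ : Measure 𝒳) (f g : 𝒳 → ℝ) : ℝ := ∫ x, f x * Real.log (f x / g x) ∂μ

variable {f g g' : 𝒳 → ℝ}

theorem measurable_log_div (hf : Measurable f) (hg : Measurable g) :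
    Measurable fun x => Real.log (f x / g x) := (hf.div hg).log

theorem integrable_mul_of_abs_le (hf : f ∈ ambientClass μ α β) {h : 𝒳 → ℝ}
    (hm : Measurable h) (M : ℝ) (hM : ∀ x, |h x| ≤ M) : Integrable (fun x => f x * h x) μ :=
  (integrable_of_mem_ambientClass hf).mul_bdd hm.aestronglyMeasurable
    (Filter.Eventually.of_forall hM)

theorem integrable_mul_log_div (hα : 0 < α) {f' : 𝒳 → ℝ} (hf : f ∈ ambientClass μ α β)
    (hf' : f' ∈ ambientClass μ α β) (hg : g ∈ ambientClass μ α β) :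
    Integrable (fun x => f x * Real.log (f' x / g x)) μ :=
  integrable_mul_of_abs_le hf (measurable_log_div hf'.1 hg.1) _
    fun x => abs_log_div_le hα (hf'.2.1 x) (hg.2.1 x)

theorem integrable_sub_sq (hf : f ∈ ambientClass μ α β) (hg : g ∈ ambientClass μ α β) :
    Integrable (fun x => (f x - g x) ^ 2) μ :=
  ((memLp_of_mem_ambientClass hf 2).sub (memLp_of_mem_ambientClass hg 2)).integrable_sq

/-- The added term `g - f` has integral `0`; it makes the integrand comparable to `(f - g) ^ 2`
pointwise. -/
theorem klDensity_eq_integral (hα : 0 < α) (hf : f ∈ ambientClass μ α β)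
    (hg : g ∈ ambientClass μ α β) :
    klDensity μ f g = ∫ x, (f x * Real.log (f x / g x) + (g x - f x)) ∂μ := by
  have hif := integrable_of_mem_ambientClass hf
  have hig := integrable_of_mem_ambientClass hg
  have hi : Integrable (fun x => g x - f x) μ := hig.sub hif
  rw [integral_add (integrable_mul_log_div hα hf hf hg) hi, integral_sub hig hif, hf.2.2, hg.2.2,
    sub_self, add_zero, klDensity]

/-- Pointwise, `hFun_mul_sq_le` at `g x / f x ≤ β / α`, followed by `f x ≤ β` in the denominator. -/
theorem cKL_mul_sq_dist2_le (hα : 0 < α) (hαβ : α < β) (hf : f ∈ ambientClass μ α β)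
    (hg : g ∈ ambientClass μ α β) : cKL α β * dist2 μ f g ^ 2 ≤ klDensity μ f g := by
  have hi := integrable_mul_log_div hα hf hf hg
  have hif := integrable_of_mem_ambientClass hf
  have hig := integrable_of_mem_ambientClass hg
  rw [klDensity_eq_integral hα hf hg, sq_dist2, ← integral_const_mul]
  refine integral_mono ((integrable_sub_sq hf hg).const_mul _) (hi.add (hig.sub hif)) fun x => ?_
  have hf0 : 0 < f x := hα.trans_le (hf.2.1 x).1
  have hg0 : 0 < g x := hα.trans_le (hg.2.1 x).1
  have hγ : 1 < β / α := (one_lt_div hα).2 hαβ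
  have h2 := hFun_mul_sq_le hγ (div_pos hg0 hf0)
    (div_le_div₀ (hα.trans hαβ).le (hg.2.1 x).2 hα (hf.2.1 x).1)
  have h3 : f x * Real.log (f x / g x) + (g x - f x)
      = f x * (g x / f x - 1 - Real.log (g x / f x)) := by
    rw [log_div_comm (f x)]
    field_simp
    ring
  have h4 : f x * (hFun (β / α) * (g x / f x - 1) ^ 2) = hFun (β / α) * (f x - g x) ^ 2 / f x := by
    field_simp
    ring
  have h5 : cKL α β * (f x - g x) ^ 2 ≤ hFun (β / α) * (f x - g x) ^ 2 / f x := by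
    rw [cKL, div_mul_eq_mul_div]
    have := (hFun_pos hγ).le
    have := (hf.2.1 x).2
    gcongr
  change cKL α β * (f x - g x) ^ 2 ≤ f x * Real.log (f x / g x) + (g x - f x)
  rw [h3]
  exact h5.trans (h4 ▸ mul_le_mul_of_nonneg_left h2 hf0.le)

theorem klDensity_le (hα : 0 < α) (hf : f ∈ ambientClass μ α β)
    (hg : g ∈ ambientClass μ α β) : klDensity μ f g ≤ dist2 μ f g ^ 2 / α := by
  have hi := integrable_mul_log_div hα hf hf hg
  have hif := integrable_of_mem_ambientClass hf
  have hig := integrable_of_mem_ambientClass hg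
  rw [klDensity_eq_integral hα hf hg, sq_dist2, ← integral_div]
  refine integral_mono (hi.add (hig.sub hif)) ((integrable_sub_sq hf hg).div_const _) fun x => ?_
  have hf0 : 0 < f x := hα.trans_le (hf.2.1 x).1
  have hg0 : 0 < g x := hα.trans_le (hg.2.1 x).1
  have h2 := Real.log_le_sub_one_of_pos (div_pos hf0 hg0)
  change f x * Real.log (f x / g x) + (g x - f x) ≤ (f x - g x) ^ 2 / α
  calc f x * Real.log (f x / g x) + (g x - f x) ≤ f x * (f x / g x - 1) + (g x - f x) := by gcongr
    _ = (f x - g x) ^ 2 / g x := by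
      field_simp
      ring
    _ ≤ (f x - g x) ^ 2 / α := by
      have := (hg.2.1 x).1
      gcongr

theorem integral_mul_log_div (hα : 0 < α) (hf : f ∈ ambientClass μ α β)
    (hg : g ∈ ambientClass μ α β) (hg' : g' ∈ ambientClass μ α β) :
    ∫ x, f x * Real.log (g' x / g x) ∂μ = klDensity μ f g - klDensity μ f g' := by
  rw [klDensity, klDensity, ← integral_sub (integrable_mul_log_div hα hf hf hg)
    (integrable_mul_log_div hα hf hf hg')]
  refine integral_congr_ae (Filter.Eventually.of_forall fun x => ?_)
  have hf0 : f x ≠ 0 := (hα.trans_le (hf.2.1 x).1).ne'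
  have hg0 : g x ≠ 0 := (hα.trans_le (hg.2.1 x).1).ne'
  have hg0' : g' x ≠ 0 := (hα.trans_le (hg'.2.1 x).1).ne'
  simp only [Real.log_div hf0 hg0, Real.log_div hf0 hg0', Real.log_div hg0' hg0]
  ring

theorem integrable_mul_log_div_sq (hα : 0 < α) (hf : f ∈ ambientClass μ α β)
    (hg : g ∈ ambientClass μ α β) (hg' : g' ∈ ambientClass μ α β) :
    Integrable (fun x => f x * Real.log (g' x / g x) ^ 2) μ :=
  integrable_mul_of_abs_le hf ((measurable_log_div hg'.1 hg.1).pow_const 2)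
    (Real.log (β / α) ^ 2) fun x => by
      rw [abs_pow]
      exact pow_le_pow_left₀ (abs_nonneg _) (abs_log_div_le hα (hg'.2.1 x) (hg.2.1 x)) 2

theorem integral_mul_log_div_sq_le (hα : 0 < α) (hf : f ∈ ambientClass μ α β)
    (hg : g ∈ ambientClass μ α β) (hg' : g' ∈ ambientClass μ α β) :
    ∫ x, f x * Real.log (g' x / g x) ^ 2 ∂μ ≤ β / α ^ 2 * dist2 μ g' g ^ 2 := by
  rw [sq_dist2, ← integral_const_mul]
  refine integral_mono (integrable_mul_log_div_sq hα hf hg hg')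
    ((integrable_sub_sq hg' hg).const_mul _) fun x => ?_
  have h1 := hf.2.1 x
  have h2 : 0 ≤ β := (hα.le.trans h1.1).trans h1.2
  calc f x * Real.log (g' x / g x) ^ 2
      ≤ β * ((g' x - g x) ^ 2 / α ^ 2) := mul_le_mul h1.2
        (log_div_sq_le hα (hg'.2.1 x).1 (hg.2.1 x).1) (sq_nonneg _) h2
    _ = β / α ^ 2 * (g' x - g x) ^ 2 := by ring

theorem integrable_mul_exp (hα : 0 < α) (hf : f ∈ ambientClass μ α β)
    (hg : g ∈ ambientClass μ α β) (hg' : g' ∈ ambientClass μ α β) (t : ℝ) :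
    Integrable (fun x => f x * Real.exp (t * Real.log (g' x / g x))) μ :=
  integrable_mul_of_abs_le hf ((measurable_log_div hg'.1 hg.1).const_mul t).exp
    (Real.exp (|t| * Real.log (β / α))) fun x => by
      rw [Real.abs_exp, Real.exp_le_exp]
      refine (le_abs_self _).trans ?_
      rw [abs_mul]
      exact mul_le_mul_of_nonneg_left (abs_log_div_le hα (hg'.2.1 x) (hg.2.1 x)) (abs_nonneg _)

/-- Expand with `exp u ≤ 1 + u + u ^ 2` for `|u| ≤ 1`: the linear term is a difference of
divergences, the quadratic one is bounded by `log_div_sq_le`. -/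
theorem integral_mul_exp_le (hα : 0 < α) (hf : f ∈ ambientClass μ α β)
    (hg : g ∈ ambientClass μ α β) (hg' : g' ∈ ambientClass μ α β) {t : ℝ} (ht : 0 ≤ t)
    (ht1 : t * Real.log (β / α) ≤ 1) :
    ∫ x, f x * Real.exp (t * Real.log (g' x / g x)) ∂μ ≤
      Real.exp (t * (klDensity μ f g - klDensity μ f g')
        + t ^ 2 * (β / α ^ 2 * dist2 μ g' g ^ 2)) := by
  have hi0 := integrable_of_mem_ambientClass hf
  have hi1 := (integrable_mul_log_div hα hf hg' hg).const_mul t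
  have hi2 := (integrable_mul_log_div_sq hα hf hg hg').const_mul (t ^ 2)
  have hi3 : Integrable (fun x => f x + t * (f x * Real.log (g' x / g x))) μ := hi0.add hi1
  calc ∫ x, f x * Real.exp (t * Real.log (g' x / g x)) ∂μ
      ≤ ∫ x, (f x + t * (f x * Real.log (g' x / g x))
          + t ^ 2 * (f x * Real.log (g' x / g x) ^ 2)) ∂μ := by
        refine integral_mono (integrable_mul_exp hα hf hg hg' t) (hi3.add hi2) fun x => ?_
        have h1 : |t * Real.log (g' x / g x)| ≤ 1 := by
          rw [abs_mul, abs_of_nonneg ht]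
          exact (mul_le_mul_of_nonneg_left (abs_log_div_le hα (hg'.2.1 x) (hg.2.1 x)) ht).trans ht1
        have h2 := (abs_le.1 (Real.abs_exp_sub_one_sub_id_le h1)).2
        have h3 := mul_le_mul_of_nonneg_left h2 (hα.le.trans (hf.2.1 x).1)
        simp only
        linarith
    _ = 1 + (t * (klDensity μ f g - klDensity μ f g')
          + t ^ 2 * ∫ x, f x * Real.log (g' x / g x) ^ 2 ∂μ) := by
        rw [integral_add hi3 hi2, integral_add hi0 hi1, integral_const_mul,
          integral_const_mul, integral_mul_log_div hα hf hg hg', hf.2.2]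
        ring
    _ ≤ 1 + (t * (klDensity μ f g - klDensity μ f g')
          + t ^ 2 * (β / α ^ 2 * dist2 μ g' g ^ 2)) := by
        gcongr
        exact integral_mul_log_div_sq_le hα hf hg hg'
    _ ≤ _ := by
        rw [add_comm]
        exact Real.add_one_le_exp _

/-- A Chernoff bound for the log-likelihood ratio of a density far from the truth against one close
to the truth. -/
theorem exists_integral_mul_exp_le (hα : 0 < α) (hαβ : α < β) {C : ℝ}
    (hC : 1 + Real.sqrt (1 / (α * cKL α β)) < C) (hf : f ∈ ambientClass μ α β)
    (hg : g ∈ ambientClass μ α β) (hg' : g' ∈ ambientClass μ α β) {δ : ℝ} (hδ : 0 < δ)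
    (hfg : dist2 μ f g ≤ δ) (hgg' : C * δ ≤ dist2 μ g g') :
    ∃ t : ℝ, 0 ≤ t ∧ ∫ x, f x * Real.exp (t * Real.log (g' x / g x)) ∂μ ≤
      Real.exp (-(LConst α β C * δ ^ 2)) := by
  have hc := cKL_pos hα hαβ
  have hK := KConst_pos hα hαβ
  have hb := log_ratio_pos hα hαβ
  have hbK := log_ratio_le_KConst hα hαβ
  have hs := sqrt_cKL_mul_sub_pos hα hαβ hC
  have hβ : 0 < β := hα.trans hαβ
  set κ := Real.sqrt (cKL α β) with hκ
  have hκ0 : 0 < κ := Real.sqrt_pos.2 hc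
  have hκ2 : κ ^ 2 = cKL α β := Real.sq_sqrt hc.le
  set b := Real.log (β / α)
  set K := KConst α β with hKdef
  have hkl0 : 0 ≤ klDensity μ f g :=
    (mul_nonneg hc.le (sq_nonneg _)).trans (cKL_mul_sq_dist2_le hα hαβ hf hg)
  set A := Real.sqrt (klDensity μ f g') with hA
  set B := Real.sqrt (klDensity μ f g) with hB
  have hA2 : A ^ 2 = klDensity μ f g' := Real.sq_sqrt
    ((mul_nonneg hc.le (sq_nonneg _)).trans (cKL_mul_sq_dist2_le hα hαβ hf hg'))
  have hB2 : B ^ 2 = klDensity μ f g := Real.sq_sqrt hkl0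
  have hA0 : 0 ≤ A := Real.sqrt_nonneg _
  have hB0 : 0 ≤ B := Real.sqrt_nonneg _
  have hAge : κ * dist2 μ f g' ≤ A := by
    refine Real.le_sqrt_of_sq_le ?_
    rw [mul_pow, hκ2]
    exact cKL_mul_sq_dist2_le hα hαβ hf hg'
  have hBge : κ * dist2 μ f g ≤ B := by
    refine Real.le_sqrt_of_sq_le ?_
    rw [mul_pow, hκ2]
    exact cKL_mul_sq_dist2_le hα hαβ hf hg
  have hBle : B ≤ Real.sqrt (1 / α) * δ := by
    refine Real.sqrt_le_iff.2 ⟨by positivity, (klDensity_le hα hf hg).trans ?_⟩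
    rw [mul_pow, Real.sq_sqrt (by positivity), div_mul_eq_mul_div, one_mul]
    have := dist2_nonneg (μ := μ) f g
    gcongr
  have htri := dist2_triangle_of_mem hg hf hg'
  rw [dist2_comm g f] at htri
  have hD : (C - 1) * δ ≤ dist2 μ f g' := by linarith
  have hAB : (κ * (C - 1) - Real.sqrt (1 / α)) * δ ≤ A - B := by
    have := mul_le_mul_of_nonneg_left hD hκ0.le
    linarith
  have hABpos : 0 < A - B := (mul_pos hs hδ).trans_le hAB
  have hApB : 0 < A + B := by linarith
  -- `K` is the constant for which `β / α ^ 2 = K * κ ^ 2`; the triangle inequality through `f` then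
  -- bounds the second moment in terms of `A + B`.
  have hv : β / α ^ 2 * dist2 μ g' g ^ 2 ≤ K * (A + B) ^ 2 := by
    have h1 : κ * dist2 μ g' g ≤ A + B := by
      rw [dist2_comm g' g]
      nlinarith
    have h2 : β / α ^ 2 * dist2 μ g' g ^ 2 = K * (κ * dist2 μ g' g) ^ 2 := by
      rw [mul_pow, hκ2, hKdef, KConst]
      field_simp
    rw [h2]
    have := dist2_nonneg (μ := μ) g' g
    gcongr
  set D := 2 * K + 2 / 3 * b with hDdef
  have hD0 : 0 < D := by positivity
  have hr : (A - B) / (A + B) ≤ 1 := (div_le_one hApB).2 (by linarith)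
  have hr0 : 0 ≤ (A - B) / (A + B) := by positivity
  -- The minimizer of `t (B² - A²) + t² K (A + B)²` is `(A - B) / ((A + B) 2K)`; replacing `2K` by
  -- the larger `D` produces the denominator of `LConst`.
  refine ⟨(A - B) / (A + B) / D, by positivity, ?_⟩
  refine (integral_mul_exp_le hα hf hg hg' (by positivity) ?_).trans (Real.exp_le_exp.2 ?_)
  · calc (A - B) / (A + B) / D * b ≤ 1 / D * b := by gcongr
      _ ≤ 1 := by
        rw [one_div, inv_mul_le_iff₀ hD0]
        linarith
  · rw [← hA2, ← hB2]
    have h1 : ((A - B) / (A + B) / D) ^ 2 * (β / α ^ 2 * dist2 μ g' g ^ 2)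
        ≤ ((A - B) / (A + B) / D) ^ 2 * (K * (A + B) ^ 2) := by gcongr
    have h2 : ((A - B) / (A + B) / D) ^ 2 * (K * (A + B) ^ 2) = (A - B) ^ 2 / D * (K / D) := by
      field_simp
    have h3 : (A - B) / (A + B) / D * (B ^ 2 - A ^ 2) = -((A - B) ^ 2 / D) := by
      field_simp
      ring
    have h4 : K / D ≤ 1 / 2 := by
      rw [div_le_div_iff₀ hD0 two_pos]
      linarith
    have h5 : (A - B) ^ 2 / D * (K / D) ≤ (A - B) ^ 2 / D * (1 / 2) := by gcongr
    have h6 : LConst α β C * δ ^ 2 ≤ (A - B) ^ 2 / D * (1 / 2) := by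
      have h7 : LConst α β C * δ ^ 2 = ((κ * (C - 1) - Real.sqrt (1 / α)) * δ) ^ 2
          / (2 * (2 * K + 2 / 3 * b)) := by
        rw [LConst, mul_pow]
        ring
      have h8 : LConst α β C * δ ^ 2 ≤ (A - B) ^ 2 / (2 * D) := by
        rw [h7]
        have h9 : 0 ≤ (κ * (C - 1) - Real.sqrt (1 / α)) * δ := by positivity
        have h10 : 2 * (2 * K + 2 / 3 * b) ≥ 2 * D := by linarith
        refine div_le_div₀ (sq_nonneg _) (pow_le_pow_left₀ h9 hAB 2) (by positivity) h10
      refine h8.trans (le_of_eq ?_)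
      field_simp
    rw [h3]
    linarith

end Divergence

/-! ### Packing numbers in star-shaped classes -/

section Packing

variable {𝒳 : Type*} [MeasurableSpace 𝒳] {μ : Measure 𝒳} {F : Set (𝒳 → ℝ)}

theorem IsPacking.card_le {r : ℝ} {S : Set (𝒳 → ℝ)} {P : Finset (𝒳 → ℝ)}
    (h : IsPacking μ r S P) : (P.card : ℕ∞) ≤ packingNumber μ r S :=
  le_iSup₂_of_le (f := fun (P : Finset (𝒳 → ℝ)) (_ : IsPacking μ r S P) => (P.card : ℕ∞)) P h le_rfl

theorem IsPacking.card_le_localPacking {f : 𝒳 → ℝ} (hf : f ∈ F) {r τ c : ℝ} (hr : τ / c ≤ r)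
    {P : Finset (𝒳 → ℝ)} (h : IsPacking μ r (F ∩ ball2 μ f τ) P) :
    (P.card : ℕ∞) ≤ localPacking μ F τ c :=
  have h' : IsPacking μ (τ / c) (F ∩ ball2 μ f τ) P :=
    ⟨h.1, h.2.imp fun _ _ hlt => hr.trans_lt hlt⟩
  le_iSup₂_of_le (f := fun f (_ : f ∈ F) => packingNumber μ (τ / c) (F ∩ ball2 μ f τ)) f hf
    h'.card_le

theorem dist2_homothety (f₀ f g : 𝒳 → ℝ) {s : ℝ} (hs : 0 ≤ s) :
    dist2 μ ((1 - s) • f₀ + s • f) ((1 - s) • f₀ + s • g) = s * dist2 μ f g := by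
  have h : ∀ x, (((1 - s) • f₀ + s • f) x - ((1 - s) • f₀ + s • g) x) ^ 2
      = s ^ 2 * (f x - g x) ^ 2 := fun x => by
    simp only [Pi.add_apply, Pi.smul_apply, smul_eq_mul]
    ring
  simp only [dist2, h, integral_const_mul]
  rw [Real.sqrt_mul (sq_nonneg s), Real.sqrt_sq hs]

/-- In a star-shaped class the local packing number decreases with the radius. -/
theorem localPacking_anti {f₀ : 𝒳 → ℝ} (hf₀ : StarConvex ℝ f₀ F) {τ τ' c : ℝ} (hτ : 0 < τ)
    (hττ' : τ ≤ τ') : localPacking μ F τ' c ≤ localPacking μ F τ c := by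
  classical
  have hτ' : 0 < τ' := hτ.trans_le hττ'
  set s := τ / τ' with hs
  have hs0 : 0 < s := div_pos hτ hτ'
  have hs1 : s ≤ 1 := (div_le_one hτ').2 hττ'
  have hsτ : s * τ' = τ := div_mul_cancel₀ _ hτ'.ne'
  -- Contraction towards the star centre: it preserves `F` and multiplies distances by exactly `s`,
  -- so it maps packings of the large ball to packings of the small one.
  set Φ : (𝒳 → ℝ) → 𝒳 → ℝ := fun g => (1 - s) • f₀ + s • g with hΦ
  have hΦF : ∀ g ∈ F, Φ g ∈ F := fun g hg =>
    hf₀ hg (sub_nonneg.2 hs1) hs0.le (sub_add_cancel _ _)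
  have hd : ∀ f g, dist2 μ (Φ f) (Φ g) = s * dist2 μ f g := fun f g =>
    dist2_homothety f₀ f g hs0.le
  have hinj : Function.Injective Φ := fun g h hgh => by
    have := add_left_cancel hgh
    exact smul_right_injective _ hs0.ne' this
  refine iSup₂_le fun f hf => iSup₂_le fun P hP => ?_
  rw [← Finset.card_image_of_injective P hinj]
  refine IsPacking.card_le_localPacking (hΦF f hf) le_rfl ⟨?_, ?_⟩
  · intro u hu
    obtain ⟨g, hg, rfl⟩ := Finset.mem_image.1 hu
    have hgF := hP.1 hg
    refine ⟨hΦF g hgF.1, ?_⟩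
    change dist2 μ (Φ f) (Φ g) ≤ τ
    rw [hd, ← hsτ]
    exact mul_le_mul_of_nonneg_left hgF.2 hs0.le
  · intro u hu v hv huv
    obtain ⟨g, hg, rfl⟩ := Finset.mem_image.1 hu
    obtain ⟨h, hh, rfl⟩ := Finset.mem_image.1 hv
    have hlt := hP.2 hg hh fun e => huv (e ▸ rfl)
    change τ / c < dist2 μ (Φ g) (Φ h)
    rw [hd, ← hsτ, mul_div_assoc]
    exact mul_lt_mul_of_pos_left hlt hs0

theorem exists_dist2_le_of_maximal_isPacking {r : ℝ} (hr : 0 ≤ r) {S : Set (𝒳 → ℝ)}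
    {P : Finset (𝒳 → ℝ)} (hP : Maximal (IsPacking μ r S) P) {f : 𝒳 → ℝ} (hf : f ∈ S) :
    ∃ u ∈ P, dist2 μ u f ≤ r := by
  classical
  by_contra! h
  have hins : IsPacking μ r S (insert f P) := by
    refine ⟨?_, ?_⟩
    · rw [Finset.coe_insert]
      exact Set.insert_subset hf hP.prop.1
    · rw [Finset.coe_insert]
      refine hP.prop.2.insert fun u hu _ => ⟨?_, h u hu⟩
      rw [dist2_comm]
      exact h u hu
  have hfP : f ∈ P := hP.le_of_ge hins (Finset.subset_insert f P) (Finset.mem_insert_self f P)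
  have := h f hfP
  rw [dist2_self] at this
  exact absurd this (not_lt.2 hr)

end Packing

/-! ### The pruning loop -/

section Clusters

variable {𝒳 : Type*} [MeasurableSpace 𝒳] {μ : Measure 𝒳} {r : ℝ}

theorem clusters_nil : clusters μ r [] = [] := by
  rw [clusters]

open Classical in
theorem clusters_cons (q : 𝒳 → ℝ) (Q : List (𝒳 → ℝ)) :
    clusters μ r (q :: Q) = (q, q :: Q.filter (fun u => dist2 μ q u ≤ r)) ::
      clusters μ r (Q.filter (fun u => ¬ dist2 μ q u ≤ r)) := by
  rw [clusters]

open Classical in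
-- The loop recurses on a filtered tail rather than on the tail itself, so the induction is on the
-- length.
theorem clusters_induction {p : List (𝒳 → ℝ) → Prop} (μ : Measure 𝒳) (r : ℝ) (nil : p [])
    (cons : ∀ q Q, p (Q.filter (fun u => ¬ dist2 μ q u ≤ r)) → p (q :: Q)) (Q : List (𝒳 → ℝ)) :
    p Q := by
  induction hn : Q.length using Nat.strong_induction_on generalizing Q with
  | _ n ih =>
    cases Q with
    | nil => exact nil
    | cons q Q =>
      refine cons q Q (ih _ ?_ _ rfl)
      rw [← hn, List.length_cons]
      exact Nat.lt_succ_of_le (List.length_filter_le _ _)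

theorem fst_mem_of_mem_clusters {Q : List (𝒳 → ℝ)} :
    ∀ s ∈ clusters μ r Q, s.1 ∈ Q := by
  classical
  induction Q using clusters_induction μ r with
  | nil => simp [clusters_nil]
  | cons q Q ih =>
    intro s hs
    rw [clusters_cons, List.mem_cons] at hs
    rcases hs with rfl | hs
    · exact List.mem_cons_self
    · exact List.mem_cons_of_mem _ (List.mem_of_mem_filter (ih s hs))

theorem snd_subset_of_mem_clusters {Q : List (𝒳 → ℝ)} :
    ∀ s ∈ clusters μ r Q, ∀ u ∈ s.2, u ∈ Q := by
  classical
  induction Q using clusters_induction μ r with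
  | nil => simp [clusters_nil]
  | cons q Q ih =>
    intro s hs u hu
    rw [clusters_cons, List.mem_cons] at hs
    rcases hs with rfl | hs
    · rcases List.mem_cons.1 hu with rfl | hu
      · exact List.mem_cons_self
      · exact List.mem_cons_of_mem _ (List.mem_of_mem_filter hu)
    · exact List.mem_cons_of_mem _ (List.mem_of_mem_filter (ih s hs u hu))

theorem dist2_le_of_mem_clusters (hr : 0 ≤ r) {Q : List (𝒳 → ℝ)} :
    ∀ s ∈ clusters μ r Q, ∀ u ∈ s.2, dist2 μ s.1 u ≤ r := by
  classical
  induction Q using clusters_induction μ r with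
  | nil => simp [clusters_nil]
  | cons q Q ih =>
    intro s hs u hu
    rw [clusters_cons, List.mem_cons] at hs
    rcases hs with rfl | hs
    · rcases List.mem_cons.1 hu with rfl | hu
      · rwa [dist2_self]
      · simpa using (List.mem_filter.1 hu).2
    · exact ih s hs u hu

theorem exists_mem_clusters {Q : List (𝒳 → ℝ)} :
    ∀ u ∈ Q, ∃ s ∈ clusters μ r Q, u ∈ s.2 := by
  classical
  induction Q using clusters_induction μ r with
  | nil => simp
  | cons q Q ih =>
    intro u hu
    rw [clusters_cons]
    rcases List.mem_cons.1 hu with rfl | hu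
    · exact ⟨_, List.mem_cons_self, List.mem_cons_self⟩
    · by_cases h : dist2 μ q u ≤ r
      · exact ⟨_, List.mem_cons_self, List.mem_cons_of_mem _ (List.mem_filter.2 ⟨hu, by simpa⟩)⟩
      · obtain ⟨s, hs, hus⟩ := ih u (List.mem_filter.2 ⟨hu, by simpa using h⟩)
        exact ⟨s, List.mem_cons_of_mem _ hs, hus⟩

/-- Whatever survives the filter is farther than `r` from `q`. Separation of the kept points bounds
the size of a level; disjointness of the clusters bounds the number of offspring. -/
theorem clusters_pairwise (hr : 0 ≤ r) {Q : List (𝒳 → ℝ)} :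
    (clusters μ r Q).Pairwise fun s s' => r < dist2 μ s.1 s'.1 ∧ ∀ u ∈ s.2, u ∉ s'.2 := by
  classical
  induction Q using clusters_induction μ r with
  | nil => simp [clusters_nil]
  | cons q Q ih =>
    rw [clusters_cons, List.pairwise_cons]
    refine ⟨fun s hs => ?_, ih⟩
    have key : ∀ u ∈ Q.filter (fun u => ¬ dist2 μ q u ≤ r), r < dist2 μ q u := fun u hu => by
      simpa using (List.mem_filter.1 hu).2
    refine ⟨key _ (fst_mem_of_mem_clusters s hs), fun u hu hus => ?_⟩
    have h1 := key u (snd_subset_of_mem_clusters s hs u hus)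
    rcases List.mem_cons.1 hu with rfl | hu
    · rw [dist2_self] at h1
      exact absurd h1 (not_lt.2 hr)
    · exact absurd h1 (not_lt.2 (by simpa using (List.mem_filter.1 hu).2))

theorem clusters_forall_ne (hr : 0 ≤ r) {Q : List (𝒳 → ℝ)} {s s' : (𝒳 → ℝ) × List (𝒳 → ℝ)}
    (hs : s ∈ clusters μ r Q) (hs' : s' ∈ clusters μ r Q) (hne : s ≠ s') :
    r < dist2 μ s.1 s'.1 ∧ ∀ u ∈ s.2, u ∉ s'.2 := by
  have hsymm : Std.Symm fun s s' : (𝒳 → ℝ) × List (𝒳 → ℝ) =>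
      r < dist2 μ s.1 s'.1 ∧ ∀ u ∈ s.2, u ∉ s'.2 :=
    ⟨fun a b h => ⟨by rw [dist2_comm]; exact h.1, fun u hu hu' => h.2 u hu' hu⟩⟩
  exact (clusters_pairwise hr).forall hs hs' hne

end Clusters

/-! ### Geometry of the pruned tree -/

section Tree

variable {𝒳 : Type*} [MeasurableSpace 𝒳] {μ : Measure 𝒳} {d c : ℝ} {T : TreeChoices 𝒳}

theorem packRadius_nonneg (hd : 0 ≤ d) (hc : 0 ≤ c) (j : ℕ) : 0 ≤ packRadius d c j := by
  unfold packRadius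
  split_ifs <;> positivity

theorem offspring_two (q : 𝒳 → ℝ) : offspring μ d c T 2 q = T.pack 2 q := by
  simp [offspring]

theorem mem_offspring {j : ℕ} (hj : 3 ≤ j) {q v : 𝒳 → ℝ} :
    v ∈ offspring μ d c T j q ↔ ∃ s ∈ clusters μ (packRadius d c j) (T.order j),
      (∃ u ∈ s.2, u ∈ T.pack j q) ∧ s.1 = v := by
  classical
  rw [offspring, if_neg (by omega)]
  simp [List.mem_map, List.mem_filter, and_assoc]

theorem level_one : level μ d c T 1 = {T.root} := by
  rw [level]

theorem mem_level_succ {j : ℕ} (hj : 1 ≤ j) {v : 𝒳 → ℝ} :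
    v ∈ level μ d c T (j + 1) ↔ ∃ q ∈ level μ d c T j, v ∈ offspring μ d c T (j + 1) q := by
  classical
  obtain ⟨i, rfl⟩ := Nat.exists_eq_add_of_le' hj
  rw [level]
  simp

/-- Choosing for each offspring an element of the packing set in its cluster is injective, since
clusters are disjoint: pruning can only merge edges. -/
theorem card_offspring_le_card_pack (hd : 0 ≤ d) (hc : 0 ≤ c) {j : ℕ} (q : 𝒳 → ℝ) :
    (offspring μ d c T j q).card ≤ (T.pack j q).card := by
  classical
  by_cases hj : j ≤ 2
  · rw [offspring, if_pos hj]
  · have h : ∀ v ∈ offspring μ d c T j q, ∃ s ∈ clusters μ (packRadius d c j) (T.order j),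
        ∃ u ∈ s.2, u ∈ T.pack j q ∧ s.1 = v := fun v hv => by
      obtain ⟨s, hs, ⟨u, hu, hup⟩, hsv⟩ := (mem_offspring (by omega)).1 hv
      exact ⟨s, hs, u, hu, hup, hsv⟩
    choose! s hs u hu hup hsv using h
    refine Finset.card_le_card_of_injOn u hup fun v hv w hw huvw => ?_
    by_contra hne
    have hsne : s v ≠ s w := fun e => hne (by rw [← hsv v hv, ← hsv w hw, e])
    exact (clusters_forall_ne (packRadius_nonneg hd hc j) (hs v hv) (hs w hw) hsne).2 (u v)
      (hu v hv) (huvw ▸ hu w hw)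

variable {F : Set (𝒳 → ℝ)} {Jt : ℕ}

theorem ballRadius_nonneg (hd : 0 ≤ d) (j : ℕ) : 0 ≤ ballRadius d j := by
  unfold ballRadius
  positivity

theorem packRadius_le (hd : 0 ≤ d) (hc : 0 < c) {j : ℕ} (hj : 2 ≤ j) :
    packRadius d c j ≤ ballRadius d j / c := by
  unfold packRadius ballRadius
  split_ifs with h
  · simp [h]
  · rw [div_div]
    have : (2 : ℝ) ^ (j - 2) ≤ 2 ^ (j - 1) := pow_le_pow_right₀ one_le_two (by omega)
    gcongr

theorem two_mul_packRadius (hc : 0 < c) {j : ℕ} (hj : 3 ≤ j) :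
    2 * packRadius d c j = ballRadius d j / c := by
  obtain ⟨i, rfl⟩ := Nat.exists_eq_add_of_le' hj
  unfold packRadius ballRadius
  rw [if_neg (by omega), show i + 3 - 1 = (i + 3 - 2) + 1 by omega, pow_succ]
  field_simp

theorem ballRadius_div_le_packRadius (hd : 0 ≤ d) (hc : 0 < c) {j : ℕ} (hj : 2 ≤ j) :
    ballRadius d j / (2 * c) ≤ packRadius d c j := by
  rcases hj.eq_or_lt with rfl | hj
  · simp only [ballRadius, packRadius, if_true, Nat.sub_self, pow_zero, div_one]
    gcongr
    linarith
  · have := two_mul_packRadius (d := d) hc hj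
    rw [mul_comm 2 c, ← div_div, ← this]
    linarith

variable {α β : ℝ}

theorem diam2_nonneg (F : Set (𝒳 → ℝ)) : 0 ≤ diam2 μ F := by
  refine Real.sSup_nonneg ?_
  rintro r ⟨f, -, g, -, rfl⟩
  exact dist2_nonneg f g

theorem IsPrunedTree.mem_of_mem_order (hT : IsPrunedTree μ F c Jt T) {j : ℕ} (hj : 3 ≤ j)
    (hjt : j ≤ Jt) {u : 𝒳 → ℝ} (hu : u ∈ T.order j) : u ∈ F := by
  obtain ⟨hpack, hord⟩ := hT.2 j (by omega) hjt
  obtain ⟨q, hq, hup⟩ := ((hord hj).2 u).1 hu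
  exact ((hpack q hq).prop.1 hup).2

theorem IsPrunedTree.offspring_subset (hT : IsPrunedTree μ F c Jt T) {j : ℕ} (hj : 2 ≤ j)
    (hjt : j ≤ Jt) {q v : 𝒳 → ℝ} (hq : q ∈ level μ (diam2 μ F) c T (j - 1))
    (hv : v ∈ offspring μ (diam2 μ F) c T j q) : v ∈ F := by
  rcases hj.eq_or_lt with rfl | hj
  · rw [offspring_two] at hv
    exact (((hT.2 2 le_rfl hjt).1 q hq).prop.1 hv).2
  · obtain ⟨s, hs, -, rfl⟩ := (mem_offspring hj).1 hv
    exact hT.mem_of_mem_order hj hjt (fst_mem_of_mem_clusters s hs)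

theorem IsPrunedTree.level_subset (hT : IsPrunedTree μ F c Jt T) {j : ℕ} (hj : 1 ≤ j)
    (hjt : j ≤ Jt) {v : 𝒳 → ℝ} (hv : v ∈ level μ (diam2 μ F) c T j) : v ∈ F := by
  rcases hj.eq_or_lt with rfl | hj
  · rw [level_one, Finset.mem_singleton] at hv
    exact hv ▸ hT.1
  · obtain ⟨i, rfl⟩ := Nat.exists_eq_add_of_le' hj
    obtain ⟨q, hq, hvq⟩ := (mem_level_succ (by omega)).1 hv
    exact hT.offspring_subset (by omega) hjt hq hvq

/-- One packing radius from `f` to the packing set, one more from the candidate to the point that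
absorbed it. From level 3 on the packing radius is halved to pay for this. -/
theorem IsPrunedTree.exists_mem_offspring [IsProbabilityMeasure μ] (hF : F ⊆ ambientClass μ α β)
    (hT : IsPrunedTree μ F c Jt T) (hc : 0 < c) {j : ℕ} (hj : 2 ≤ j) (hjt : j ≤ Jt)
    {q f : 𝒳 → ℝ} (hq : q ∈ level μ (diam2 μ F) c T (j - 1)) (hf : f ∈ F)
    (hqf : dist2 μ q f ≤ ballRadius (diam2 μ F) j) :
    ∃ v ∈ offspring μ (diam2 μ F) c T j q, dist2 μ f v ≤ ballRadius (diam2 μ F) j / c := by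
  have hd := diam2_nonneg (μ := μ) F
  have hr := packRadius_nonneg hd hc.le j
  obtain ⟨hpack, hord⟩ := hT.2 j hj hjt
  obtain ⟨u, hu, huf⟩ := exists_dist2_le_of_maximal_isPacking hr (hpack q hq) ⟨hqf, hf⟩
  rcases hj.eq_or_lt with rfl | hj
  · refine ⟨u, by rwa [offspring_two], ?_⟩
    rw [dist2_comm]
    exact huf.trans (packRadius_le hd hc le_rfl)
  · obtain ⟨s, hs, hus⟩ := exists_mem_clusters (μ := μ) (r := packRadius (diam2 μ F) c j) u
      (((hord hj).2 u).2 ⟨q, hq, hu⟩)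
    refine ⟨s.1, (mem_offspring hj).2 ⟨s, hs, ⟨u, hus, hu⟩, rfl⟩, ?_⟩
    have h1 := dist2_le_of_mem_clusters hr s hs u hus
    have h2 := dist2_triangle_of_mem (hF hf) (hF ((hpack q hq).prop.1 hu).2)
      (hF (hT.mem_of_mem_order hj hjt (fst_mem_of_mem_clusters s hs)))
    rw [dist2_comm f u, dist2_comm u s.1] at h2
    rw [← two_mul_packRadius hc hj]
    linarith

theorem IsPrunedTree.dist2_offspring_le [IsProbabilityMeasure μ]
    (hF : F ⊆ ambientClass μ α β)
    (hT : IsPrunedTree μ F c Jt T) (hc : 1 ≤ c) {j : ℕ} (hj : 2 ≤ j) (hjt : j ≤ Jt)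
    {q v : 𝒳 → ℝ} (hq : q ∈ level μ (diam2 μ F) c T (j - 1))
    (hv : v ∈ offspring μ (diam2 μ F) c T j q) :
    dist2 μ q v ≤ 2 * ballRadius (diam2 μ F) j := by
  have hd := diam2_nonneg (μ := μ) F
  have hb := ballRadius_nonneg hd j
  have hc0 : 0 < c := by linarith
  obtain ⟨hpack, hord⟩ := hT.2 j hj hjt
  rcases hj.eq_or_lt with rfl | hj
  · rw [offspring_two] at hv
    have h1 : dist2 μ q v ≤ ballRadius (diam2 μ F) 2 := ((hpack q hq).prop.1 hv).1
    linarith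
  · obtain ⟨s, hs, ⟨u, hus, hu⟩, rfl⟩ := (mem_offspring hj).1 hv
    have h1 := dist2_le_of_mem_clusters (packRadius_nonneg hd hc0.le j) s hs u hus
    have h2 : dist2 μ q u ≤ ballRadius (diam2 μ F) j := ((hpack q hq).prop.1 hu).1
    have h3 := dist2_triangle_of_mem (hF (hT.level_subset (by omega) (by omega) hq))
      (hF ((hpack q hq).prop.1 hu).2)
      (hF (hT.mem_of_mem_order hj hjt (fst_mem_of_mem_clusters s hs)))
    rw [dist2_comm u s.1] at h3
    have h4 := packRadius_le hd hc0 (by omega : 2 ≤ j)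
    have h5 := div_le_self hb hc
    linarith

/-- This is the purpose of pruning: nodes coming from different parents are separated too, so those
near `f` form a single local packing. -/
theorem IsPrunedTree.level_pairwise (hT : IsPrunedTree μ F c Jt T) (hc : 0 < c) {j : ℕ}
    (hj : 2 ≤ j) (hjt : j ≤ Jt) : (level μ (diam2 μ F) c T (j - 1) : Set (𝒳 → ℝ)).Pairwise
      fun g h => ballRadius (diam2 μ F) j / (2 * c) < dist2 μ g h := by
  have hd := diam2_nonneg (μ := μ) F
  have hb : ∀ {i}, 2 ≤ i → ballRadius (diam2 μ F) (i + 1) / (2 * c) ≤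
      packRadius (diam2 μ F) c i := fun {i} hi => by
    refine le_trans ?_ (ballRadius_div_le_packRadius hd hc hi)
    unfold ballRadius
    have : (2 : ℝ) ^ (i - 2) ≤ 2 ^ (i + 1 - 2) := pow_le_pow_right₀ one_le_two (by omega)
    gcongr
  obtain ⟨i, rfl⟩ := Nat.exists_eq_add_of_le' hj
  rw [show i + 2 - 1 = i + 1 by omega]
  rcases i with _ | _ | i
  · rw [level_one, Finset.coe_singleton]
    exact Set.pairwise_singleton _ _
  · intro g hg h hh hgh
    obtain ⟨q, hq, hg⟩ := (mem_level_succ le_rfl).1 hg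
    obtain ⟨q', hq', hh⟩ := (mem_level_succ le_rfl).1 hh
    rw [level_one, Finset.mem_singleton] at hq hq'
    subst hq hq'
    rw [offspring_two] at hg hh
    exact (hb le_rfl).trans_lt (((hT.2 2 le_rfl (by omega)).1 T.root
      (by rw [level_one]; exact Finset.mem_singleton_self _)).prop.2 hg hh hgh)
  · intro g hg h hh hgh
    obtain ⟨q, hq, hg⟩ := (mem_level_succ (by omega)).1 hg
    obtain ⟨q', hq', hh⟩ := (mem_level_succ (by omega)).1 hh
    obtain ⟨s, hs, -, rfl⟩ := (mem_offspring (by omega)).1 hg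
    obtain ⟨s', hs', -, rfl⟩ := (mem_offspring (by omega)).1 hh
    exact (hb (by omega)).trans_lt (clusters_forall_ne (packRadius_nonneg hd hc.le _) hs hs'
      fun e => hgh (by rw [e])).1

open Classical in
theorem IsPrunedTree.card_near_le (hT : IsPrunedTree μ F c Jt T) (hc : 0 < c) {j : ℕ}
    (hj : 2 ≤ j) (hjt : j ≤ Jt) {f : 𝒳 → ℝ} (hf : f ∈ F) :
    (((level μ (diam2 μ F) c T (j - 1)).filter
      fun q => dist2 μ q f ≤ ballRadius (diam2 μ F) j).card : ℕ∞) ≤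
      localPacking μ F (ballRadius (diam2 μ F) j) (2 * c) := by
  refine IsPacking.card_le_localPacking hf le_rfl ⟨fun q hq => ?_, ?_⟩
  · obtain ⟨hq, hqf⟩ := Finset.mem_filter.1 hq
    refine ⟨hT.level_subset (by omega) (by omega) hq, ?_⟩
    change dist2 μ f q ≤ _
    rwa [dist2_comm]
  · exact (hT.level_pairwise hc hj hjt).mono fun q hq => (Finset.mem_filter.1 hq).1

theorem IsPrunedTree.card_offspring_le (hT : IsPrunedTree μ F c Jt T) (hc : 0 < c) {j : ℕ}
    (hj : 2 ≤ j) (hjt : j ≤ Jt) {q : 𝒳 → ℝ} (hq : q ∈ level μ (diam2 μ F) c T (j - 1)) :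
    ((offspring μ (diam2 μ F) c T j q).card : ℕ∞) ≤
      localPacking μ F (ballRadius (diam2 μ F) j) (2 * c) := by
  have hd := diam2_nonneg (μ := μ) F
  refine le_trans (Nat.cast_le.2 (card_offspring_le_card_pack hd hc.le q)) ?_
  refine IsPacking.card_le_localPacking (hT.level_subset (by omega) (by omega) hq)
    (ballRadius_div_le_packRadius hd hc hj) ?_
  rw [Set.inter_comm]
  exact ((hT.2 j hj hjt).1 q hq).prop

end Tree

/-! ### Error probability of one group-majority comparison -/

section Comparison

variable {𝒳 : Type*} {N m : ℕ}

open Classical in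
/-- The groups in which the log-likelihood difference between `g` and `g₀` is nonnegative. -/
noncomputable def nonnegGroups (G : Fin N → Fin m) (x : Fin N → 𝒳) (g g₀ : 𝒳 → ℝ) :
    Finset (Fin m) :=
  Finset.univ.filter fun j => 0 ≤ ∑ i with G i = j, Real.log (g (x i) / g₀ (x i))

theorem beats_iff {G : Fin N → Fin m} {x : Fin N → 𝒳} {g g' : 𝒳 → ℝ} :
    Beats G x g g' ↔ (m : ℝ) / 2 ≤ (m : ℝ) - (nonnegGroups G x g' g).card := by
  classical
  have h : ({j : Fin m | 0 < ∑ i with G i = j, Real.log (g (x i) / g' (x i))} : Set (Fin m)) =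
      (((nonnegGroups G x g' g)ᶜ : Finset (Fin m)) : Set (Fin m)) := by
    ext j
    simp only [nonnegGroups, Finset.coe_compl, Finset.coe_filter, Finset.mem_univ, true_and,
      Set.mem_compl_iff, Set.mem_ofPred_eq, not_le, fun i => log_div_comm (g' (x i)),
      Finset.sum_neg_distrib, Left.neg_neg_iff]
  rw [Beats, h, Set.ncard_coe_finset, Finset.card_compl, Fintype.card_fin,
    Nat.cast_sub (by simpa using Finset.card_le_univ (nonnegGroups G x g' g))]

theorem beats_of_card_lt {G : Fin N → Fin m} {x : Fin N → 𝒳} {g g' : 𝒳 → ℝ}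
    (h : ((nonnegGroups G x g' g).card : ℝ) < m / 2) : Beats G x g g' := by
  rw [beats_iff]
  linarith

theorem not_beats_of_card_lt {G : Fin N → Fin m} {x : Fin N → 𝒳} {g g' : 𝒳 → ℝ}
    (h : ((nonnegGroups G x g g').card : ℝ) < m / 2) : ¬ Beats G x g g' := by
  classical
  have hsub : ({j : Fin m | 0 < ∑ i with G i = j, Real.log (g (x i) / g' (x i))} : Set (Fin m)) ⊆
      (nonnegGroups G x g g' : Set (Fin m)) := fun j hj => by
    simpa [nonnegGroups] using (show (0 : ℝ) < _ from hj).le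
  have h1 := Set.ncard_le_ncard hsub (Finset.finite_toSet _)
  rw [Set.ncard_coe_finset] at h1
  rw [Beats, not_le]
  exact lt_of_le_of_lt (Nat.cast_le.2 h1) h

theorem card_fiber_mem_ge {G : Fin N → Fin m} (hG : IsBalanced G) (hm : 1 ≤ m)
    (hmN : m ≤ max N 1) (A : Finset (Fin m)) (hA : (m : ℝ) / 6 ≤ A.card) :
    (N : ℝ) / 12 ≤ (Finset.univ.filter fun i => G i ∈ A).card := by
  classical
  have h1 : (Finset.univ.filter fun i => G i ∈ A).card =
      ∑ j ∈ A, (Finset.univ.filter fun i => G i = j).card := by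
    have hmaps : Set.MapsTo G (Finset.univ.filter fun i => G i ∈ A : Finset (Fin N)) A :=
      fun i hi => (Finset.mem_filter.1 (Finset.mem_coe.1 hi)).2
    rw [Finset.card_eq_sum_card_fiberwise hmaps]
    refine Finset.sum_congr rfl fun j hj => ?_
    congr 1
    ext i
    simp only [Finset.mem_filter, Finset.mem_univ, true_and, and_iff_right_iff_imp]
    rintro rfl
    exact hj
  have h2 : A.card * (N / m) ≤ (Finset.univ.filter fun i => G i ∈ A).card := by
    rw [h1, ← smul_eq_mul]
    exact Finset.card_nsmul_le_sum _ _ _ fun j _ => (hG j).1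
  -- Since `m ≤ N` when `N > 0`, the rounded quotient is at least `1` and rounding loses at most
  -- half of `N`; hence `1 / 12` from `1 / 6`.
  have h3 : N ≤ 2 * (m * (N / m)) := by
    rcases Nat.eq_zero_or_pos N with rfl | hN
    · simp
    · have h4 : m ≤ N := by omega
      have h5 : 1 ≤ N / m := (Nat.one_le_div_iff (by omega)).2 h4
      have h6 := Nat.div_add_mod N m
      have h7 := Nat.mod_lt N (by omega : 0 < m)
      have h8 : m * 1 ≤ m * (N / m) := Nat.mul_le_mul_left _ h5
      omega
  have h2' : (A.card : ℝ) * (N / m : ℕ) ≤ (Finset.univ.filter fun i => G i ∈ A).card := by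
    exact_mod_cast h2
  have h3' : (N : ℝ) ≤ 2 * (m * (N / m : ℕ)) := by exact_mod_cast h3
  have h9 : (m : ℝ) / 6 * (N / m : ℕ) ≤ A.card * (N / m : ℕ) := by gcongr
  linarith

/-- A group can change its sign only if it contains a changed observation, and each observation lies
in one group. -/
theorem card_nonnegGroups_le_add {G : Fin N → Fin m} (x y : Fin N → 𝒳) (g g₀ : 𝒳 → ℝ) :
    (nonnegGroups G x g g₀).card ≤
      (nonnegGroups G y g g₀).card + ({i : Fin N | x i ≠ y i} : Set (Fin N)).ncard := by
  classical
  set I : Finset (Fin N) := Finset.univ.filter fun i => x i ≠ y i with hI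
  have hIc : ({i : Fin N | x i ≠ y i} : Set (Fin N)).ncard = I.card := by
    rw [← Set.ncard_coe_finset]
    congr 1
    ext i
    simp [hI]
  have hsub : nonnegGroups G x g g₀ ⊆ nonnegGroups G y g g₀ ∪ I.image G := by
    intro j hj
    rw [Finset.mem_union]
    by_cases h : j ∈ I.image G
    · exact Or.inr h
    · left
      have heq : ∀ i, G i = j → x i = y i := fun i hi => by
        by_contra hne
        exact h (Finset.mem_image.2 ⟨i, by simp [hI, hne], hi⟩)
      simp only [nonnegGroups, Finset.mem_filter, Finset.mem_univ, true_and] at hj ⊢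
      refine hj.trans_eq (Finset.sum_congr rfl fun i hi => ?_)
      rw [heq i (by simpa using hi)]
  rw [hIc]
  exact (Finset.card_le_card hsub).trans ((Finset.card_union_le _ _).trans
    (Nat.add_le_add_left Finset.card_image_le _))

variable [MeasurableSpace 𝒳] {μ : Measure 𝒳} {α β C ε : ℝ} {f g g' : 𝒳 → ℝ}
  {Ω : Type*} [MeasurableSpace Ω] {P : Measure Ω}
  {Xt X : Fin N → Ω → 𝒳}

theorem mgf_log_ratio (hα : 0 < α) (hf : f ∈ ambientClass μ α β)
    (hg : g ∈ ambientClass μ α β) (hg' : g' ∈ ambientClass μ α β)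
    (hX : IsCorruptedSample μ f ε P Xt X) (i : Fin N) (t : ℝ) :
    mgf (fun ω => Real.log (g' (Xt i ω) / g (Xt i ω))) P t =
      ∫ x, f x * Real.exp (t * Real.log (g' x / g x)) ∂μ := by
  obtain ⟨hmeas, -, hlaw, -⟩ := hX
  have hm : Measurable fun x => Real.exp (t * Real.log (g' x / g x)) :=
    ((measurable_log_div hg'.1 hg.1).const_mul t).exp
  have h1 : mgf (fun ω => Real.log (g' (Xt i ω) / g (Xt i ω))) P t =
      ∫ x, Real.exp (t * Real.log (g' x / g x)) ∂(P.map (Xt i)) := by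
    rw [integral_map (hmeas i).aemeasurable hm.aestronglyMeasurable]
    rfl
  rw [h1, hlaw, integral_withDensity_eq_integral_toReal_smul hf.1.ennreal_ofReal
    (Filter.Eventually.of_forall fun x => ENNReal.ofReal_lt_top)]
  refine integral_congr_ae (Filter.Eventually.of_forall fun x => ?_)
  simp only [smul_eq_mul]
  rw [ENNReal.toReal_ofReal (hα.le.trans (hf.2.1 x).1)]

variable [IsProbabilityMeasure μ] [IsProbabilityMeasure P]

/-- Chernoff for the clean sample over a fixed index set; the tilt of `exists_integral_mul_exp_le`
serves all observations because they have the same law. -/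
theorem measureReal_sum_log_ratio_nonneg_le (hα : 0 < α) (hαβ : α < β)
    (hC : 1 + Real.sqrt (1 / (α * cKL α β)) < C) (hf : f ∈ ambientClass μ α β)
    (hg : g ∈ ambientClass μ α β) (hg' : g' ∈ ambientClass μ α β) {δ : ℝ} (hδ : 0 < δ)
    (hfg : dist2 μ f g ≤ δ) (hgg' : C * δ ≤ dist2 μ g g')
    (hX : IsCorruptedSample μ f ε P Xt X) (s : Finset (Fin N)) :
    P.real {ω | 0 ≤ ∑ i ∈ s, Real.log (g' (Xt i ω) / g (Xt i ω))} ≤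
      Real.exp (-(s.card * (LConst α β C * δ ^ 2))) := by
  obtain ⟨t, ht, hmgf⟩ := exists_integral_mul_exp_le hα hαβ hC hf hg hg' hδ hfg hgg'
  set Y : Fin N → Ω → ℝ := fun i ω => Real.log (g' (Xt i ω) / g (Xt i ω)) with hY
  have hYm : ∀ i, Measurable (Y i) := fun i => (measurable_log_div hg'.1 hg.1).comp (hX.1 i)
  have hYi : iIndepFun Y P := hX.2.1.comp _ fun _ => measurable_log_div hg'.1 hg.1
  have hint : ∀ i, Integrable (fun ω => Real.exp (t * Y i ω)) P := fun i => by
    refine Integrable.of_bound ((hYm i).const_mul t).exp.aestronglyMeasurable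
      (Real.exp (t * Real.log (β / α))) (Filter.Eventually.of_forall fun ω => ?_)
    rw [Real.norm_eq_abs, Real.abs_exp, Real.exp_le_exp]
    exact mul_le_mul_of_nonneg_left (log_div_le_log_div hα (hg'.2.1 _) (hg.2.1 _)) ht
  have h1 := measure_ge_le_exp_mul_mgf (μ := P) (X := ∑ i ∈ s, Y i) 0 ht
    (hYi.integrable_exp_mul_sum hYm fun i _ => hint i)
  rw [hYi.mgf_sum hYm, mul_zero, Real.exp_zero, one_mul] at h1
  have h2 : {ω | 0 ≤ (∑ i ∈ s, Y i) ω} =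
      {ω | 0 ≤ ∑ i ∈ s, Real.log (g' (Xt i ω) / g (Xt i ω))} := by
    ext ω
    simp [hY]
  rw [h2] at h1
  refine h1.trans ?_
  calc ∏ i ∈ s, mgf (Y i) P t ≤ ∏ _i ∈ s, Real.exp (-(LConst α β C * δ ^ 2)) :=
        Finset.prod_le_prod (fun i _ => mgf_nonneg) fun i _ =>
          (mgf_log_ratio hα hf hg hg' hX i t).trans_le hmgf
    _ = _ := by
        rw [Finset.prod_const, ← Real.exp_nat_mul]
        congr 1
        ring

/-- If `m / 2` observed groups are bad, at least `m / 2 - ε N ≥ m / 6` clean groups are bad, and the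
log-ratio summed over their union is nonnegative. Summing over all possible sets of groups removes
the dependence on the adversary. -/
theorem measureReal_le_card_nonnegGroups_le (hα : 0 < α) (hαβ : α < β)
    (hC : 1 + Real.sqrt (1 / (α * cKL α β)) < C) (hf : f ∈ ambientClass μ α β)
    (hg : g ∈ ambientClass μ α β) (hg' : g' ∈ ambientClass μ α β) {δ : ℝ} (hδ : 0 < δ)
    (hfg : dist2 μ f g ≤ δ) (hgg' : C * δ ≤ dist2 μ g g')
    (hX : IsCorruptedSample μ f ε P Xt X) {G : Fin N → Fin m} (hG : IsBalanced G)
    (hε : ε ≤ 1 / 3) (hm : (m : ℝ) = max (3 * ε * N) 1) :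
    P.real {ω | (m : ℝ) / 2 ≤ (nonnegGroups G (fun i => X i ω) g' g).card} ≤
      2 ^ m * Real.exp (-(N * (LConst α β C * δ ^ 2) / 12)) := by
  classical
  have hm1 : 1 ≤ m := by
    have : (1 : ℝ) ≤ m := hm ▸ le_max_right _ _
    exact_mod_cast this
  have hmN : m ≤ max N 1 := by
    have h1 : (m : ℝ) ≤ max (N : ℝ) 1 := by
      rw [hm]
      refine max_le_max ?_ le_rfl
      have : (0 : ℝ) ≤ N := Nat.cast_nonneg N
      nlinarith
    exact_mod_cast h1
  have hεm : ε * N ≤ m / 3 := by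
    have : 3 * ε * N ≤ m := hm ▸ le_max_left _ _
    linarith
  have hL := LConst_pos hα hαβ hC
  set S : Finset (Fin m) → Set Ω := fun A =>
    {ω | 0 ≤ ∑ i with G i ∈ A, Real.log (g' (Xt i ω) / g (Xt i ω))} with hS
  set 𝒜 : Finset (Finset (Fin m)) :=
    Finset.univ.filter fun A => (m : ℝ) / 6 ≤ A.card with h𝒜
  have hsub : {ω | (m : ℝ) / 2 ≤ (nonnegGroups G (fun i => X i ω) g' g).card} ≤ᵐ[P]
      ⋃ A ∈ 𝒜, S A := by
    filter_upwards [hX.2.2.2.2] with ω hω hcard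
    set A := nonnegGroups G (fun i => Xt i ω) g' g with hA
    have hcard' : (m : ℝ) / 2 ≤ (nonnegGroups G (fun i => X i ω) g' g).card := hcard
    have h1 : ((nonnegGroups G (fun i => X i ω) g' g).card : ℝ) ≤
        A.card + (({i : Fin N | X i ω ≠ Xt i ω} : Set (Fin N)).ncard : ℝ) := by
      exact_mod_cast card_nonnegGroups_le_add (fun i => X i ω) (fun i => Xt i ω) g' g
    refine Set.mem_biUnion (x := A) ?_ ?_
    · rw [h𝒜, Finset.coe_filter]
      refine ⟨Finset.mem_univ _, ?_⟩
      linarith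
    · have h2 : ∑ i with G i ∈ A, Real.log (g' (Xt i ω) / g (Xt i ω)) =
          ∑ j ∈ A, ∑ i with G i = j, Real.log (g' (Xt i ω) / g (Xt i ω)) := by
        rw [← Finset.sum_fiberwise_of_maps_to (g := G) (t := A) fun i hi =>
          (Finset.mem_filter.1 hi).2]
        refine Finset.sum_congr rfl fun j hj => Finset.sum_congr ?_ fun _ _ => rfl
        ext i
        simp only [Finset.mem_filter, Finset.mem_univ, true_and, and_iff_right_iff_imp]
        rintro rfl
        exact hj
      change 0 ≤ ∑ i with G i ∈ A, Real.log (g' (Xt i ω) / g (Xt i ω))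
      rw [h2]
      exact Finset.sum_nonneg fun j hj => (Finset.mem_filter.1 hj).2
  have hle : P.real {ω | (m : ℝ) / 2 ≤ (nonnegGroups G (fun i => X i ω) g' g).card} ≤
      P.real (⋃ A ∈ 𝒜, S A) :=
    ENNReal.toReal_mono (measure_ne_top _ _) (measure_mono_ae hsub)
  refine hle.trans ((measureReal_biUnion_finset_le 𝒜 S).trans ?_)
  have hbound : ∀ A ∈ 𝒜, P.real (S A) ≤ Real.exp (-(N * (LConst α β C * δ ^ 2) / 12)) := by
    intro A hA
    refine (measureReal_sum_log_ratio_nonneg_le hα hαβ hC hf hg hg' hδ hfg hgg' hX _).trans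
      (Real.exp_le_exp.2 ?_)
    have h1 := card_fiber_mem_ge hG hm1 hmN A (Finset.mem_filter.1 hA).2
    have h2 : 0 ≤ LConst α β C * δ ^ 2 := by positivity
    have h3 := mul_le_mul_of_nonneg_right h1 h2
    linarith
  refine (Finset.sum_le_card_nsmul 𝒜 _ _ hbound).trans ?_
  rw [nsmul_eq_mul]
  have h𝒜c : (𝒜.card : ℝ) ≤ 2 ^ m := by
    have : 𝒜.card ≤ 2 ^ m := by
      refine (Finset.card_le_univ 𝒜).trans ?_
      simp
    exact_mod_cast this
  gcongr

end Comparison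

/-! ### Measurability of maps with finitely many values -/

section FiniteFibres

/-- The values are functions or finite sets of functions, with no σ-algebra in play; measurability
is checked fibre by fibre, which suffices for a finite range. -/
theorem measurableSet_of_finite_fibres {X V : Type*} [MeasurableSpace X] {h : X → V}
    (s : Finset V) (hs : ∀ x, h x ∈ s) (hm : ∀ v ∈ s, MeasurableSet {x | h x = v})
    {p : X → V → Prop} (hp : ∀ v ∈ s, MeasurableSet {x | p x v}) :
    MeasurableSet {x | p x (h x)} := by
  have : {x | p x (h x)} = ⋃ v ∈ s, {x | h x = v} ∩ {x | p x v} := by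
    ext x
    simp only [Set.mem_ofPred_eq, Set.mem_iUnion, Set.mem_inter_iff, exists_prop]
    constructor
    · exact fun hx => ⟨h x, hs x, rfl, hx⟩
    · rintro ⟨v, -, rfl, hx⟩
      exact hx
  rw [this]
  exact s.measurableSet_biUnion fun v hv => (hm v hv).inter (hp v hv)

theorem measurableSet_filter_eq {X V : Type*} [MeasurableSpace X] (S S' : Finset V)
    {p : X → V → Prop} [∀ x, DecidablePred (p x)] (hp : ∀ v ∈ S, MeasurableSet {x | p x v}) :
    MeasurableSet {x | S.filter (p x) = S'} := by
  by_cases hS : S' ⊆ S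
  · have : {x | S.filter (p x) = S'} = ⋂ v ∈ S, {x | p x v ↔ v ∈ S'} := by
      ext x
      simp only [Set.mem_ofPred_eq, Set.mem_iInter, Finset.ext_iff, Finset.mem_filter]
      constructor
      · intro h v hv
        rw [← h v, and_iff_right hv]
      · intro h v
        constructor
        · rintro ⟨hv, hpv⟩
          exact (h v hv).1 hpv
        · exact fun hv => ⟨hS hv, (h v (hS hv)).2 hv⟩
    rw [this]
    refine S.measurableSet_biInter fun v hv => ?_
    by_cases hvS : v ∈ S'
    · simpa [hvS] using hp v hv
    · have : {x | p x v ↔ v ∈ S'} = {x | p x v}ᶜ := by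
        ext x
        simp [hvS]
      rw [this]
      exact (hp v hv).compl
  · have : {x | S.filter (p x) = S'} = ∅ := by
      ext x
      simp only [Set.mem_ofPred_eq, Set.mem_empty_iff_false, iff_false]
      rintro rfl
      exact hS (Finset.filter_subset _ _)
    rw [this]
    exact MeasurableSet.empty

end FiniteFibres

/-! ### The minimizers of the score -/

section Estimator

variable {𝒳 : Type*} [MeasurableSpace 𝒳] {μ : Measure 𝒳} {N m : ℕ} {G : Fin N → Fin m}
  {C δ : ℝ} {S : Finset (𝒳 → ℝ)} {x : Fin N → 𝒳}

theorem measurable_card_nonnegGroups {g g' : 𝒳 → ℝ} (hg : Measurable g) (hg' : Measurable g') :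
    Measurable fun x : Fin N → 𝒳 => ((nonnegGroups G x g g').card : ℝ) := by
  classical
  simp only [nonnegGroups, Finset.card_filter, Nat.cast_sum]
  refine Finset.measurable_sum _ fun j _ => ?_
  have hs : MeasurableSet {x : Fin N → 𝒳 | 0 ≤ ∑ i with G i = j, Real.log (g (x i) / g' (x i))} :=
    measurableSet_le measurable_const (Finset.measurable_sum _ fun i _ =>
      (measurable_log_div hg hg').comp (measurable_pi_apply i))
  simp only [Nat.cast_ite]
  exact Measurable.ite hs measurable_const measurable_const

theorem measurableSet_beats {g g' : 𝒳 → ℝ} (hg : Measurable g) (hg' : Measurable g') :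
    MeasurableSet {x : Fin N → 𝒳 | Beats G x g g'} := by
  simp only [beats_iff]
  exact measurableSet_le measurable_const
    (measurable_const.sub (measurable_card_nonnegGroups hg' hg))

open Classical in
/-- The greatest distance to `ν` in a finite set. -/
noncomputable def maxDist (μ : Measure 𝒳) (ν : 𝒳 → ℝ) (A : Finset (𝒳 → ℝ)) : ℝ :=
  if h : A.Nonempty then A.sup' h (fun ν' => dist2 μ ν ν') else 0

theorem measurableSet_bestSet_eq (hS : ∀ g ∈ S, Measurable g) (S' : Finset (𝒳 → ℝ)) :
    MeasurableSet {x : Fin N → 𝒳 | bestSet μ G C δ S x = S'} := by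
  classical
  have hsub : ∀ (ν : 𝒳 → ℝ) (x : Fin N → 𝒳), betterFar μ G C δ S x ν ∈ S.powerset := fun ν x =>
    Finset.mem_powerset.2 (Finset.filter_subset _ _)
  have hfar : ∀ ν ∈ S, ∀ A, MeasurableSet {x : Fin N → 𝒳 | betterFar μ G C δ S x ν = A} := by
    intro ν hν A
    refine measurableSet_filter_eq S A
      (p := fun x ν' => Beats G x ν' ν ∧ C * δ ≤ dist2 μ ν ν') fun ν' hν' => ?_
    exact (measurableSet_beats (hS ν' hν') (hS ν hν)).inter (MeasurableSet.const _)
  refine measurableSet_filter_eq S S'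
    (p := fun x ν => ∀ ν' ∈ S, score μ G C δ S x ν ≤ score μ G C δ S x ν') fun ν hν => ?_
  have : {x : Fin N → 𝒳 | ∀ ν' ∈ S, score μ G C δ S x ν ≤ score μ G C δ S x ν'} =
      ⋂ ν' ∈ S, {x | score μ G C δ S x ν ≤ score μ G C δ S x ν'} := by
    ext x
    simp
  rw [this]
  refine S.measurableSet_biInter fun ν' hν' => ?_
  refine measurableSet_of_finite_fibres (h := fun x => betterFar μ G C δ S x ν) S.powerset
    (hsub ν) (fun A _ => hfar ν hν A)
    (p := fun x A => maxDist μ ν A ≤ score μ G C δ S x ν') fun A _ => ?_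
  exact measurableSet_of_finite_fibres (h := fun x => betterFar μ G C δ S x ν') S.powerset
    (hsub ν') (fun A _ => hfar ν' hν' A)
    (p := fun _ A' => maxDist μ ν A ≤ maxDist μ ν' A') fun A' _ => MeasurableSet.const _

theorem bestSet_subset : bestSet μ G C δ S x ⊆ S := Finset.filter_subset _ _

theorem bestSet_nonempty (hS : S.Nonempty) : (bestSet μ G C δ S x).Nonempty := by
  obtain ⟨ν, hν, hmin⟩ := S.exists_min_image (score μ G C δ S x) hS
  exact ⟨ν, Finset.mem_filter.2 ⟨hν, hmin⟩⟩

/-- Since `g₀` defeats every far competitor and is beaten by none of them, its score is `0`, whereas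
a far `ν` has `g₀` in its `betterFar` set and so a score of at least `C * δ`. -/
theorem dist2_lt_of_mem_bestSet (hδ : 0 < C * δ) {g₀ ν : 𝒳 → ℝ} (hg₀ : g₀ ∈ S)
    (hν : ν ∈ bestSet μ G C δ S x)
    (hbad : ∀ g ∈ S, C * δ ≤ dist2 μ g₀ g → ((nonnegGroups G x g g₀).card : ℝ) < m / 2) :
    dist2 μ g₀ ν < C * δ := by
  classical
  by_contra! hfar
  obtain ⟨hνS, hmin⟩ := Finset.mem_filter.1 hν
  have h0 : score μ G C δ S x g₀ = 0 := by
    rw [score, dif_neg]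
    rintro ⟨g, hg⟩
    obtain ⟨hgS, hbeat, hd⟩ := Finset.mem_filter.1 hg
    exact not_beats_of_card_lt (hbad g hgS hd) hbeat
  have hmem : g₀ ∈ betterFar μ G C δ S x ν := by
    refine Finset.mem_filter.2 ⟨hg₀, beats_of_card_lt (hbad ν hνS hfar), ?_⟩
    rwa [dist2_comm]
  have h1 : dist2 μ ν g₀ ≤ score μ G C δ S x ν := by
    rw [score, dif_pos ⟨g₀, hmem⟩]
    exact Finset.le_sup' (fun ν' => dist2 μ ν ν') hmem
  have h2 := hmin g₀ hg₀
  rw [dist2_comm] at hfar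
  linarith

end Estimator

/-! ### The random path down the tree -/

section Sieve

variable {𝒳 : Type*} [MeasurableSpace 𝒳] {μ : Measure 𝒳} [IsProbabilityMeasure μ] {α β : ℝ}
  {F : Set (𝒳 → ℝ)} {N m : ℕ} {G : Fin N → Fin m} {C : ℝ} {Jt : ℕ} {T : TreeChoices 𝒳}
  {pick : (Fin N → 𝒳) → Finset (𝒳 → ℝ) → (𝒳 → ℝ)}

theorem IsPrunedTree.sieve_succ_mem (hF : F ⊆ ambientClass μ α β) (hC : 0 < C)
    (hT : IsPrunedTree μ F (2 * (C + 1)) Jt T) (hpick : IsTieBreak pick) (x : Fin N → 𝒳) {k : ℕ}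
    (hk : k + 2 ≤ Jt)
    (hmem : sieve μ (diam2 μ F) C T G pick x (k + 1) ∈
      level μ (diam2 μ F) (2 * (C + 1)) T (k + 1)) :
    sieve μ (diam2 μ F) C T G pick x (k + 2) ∈
      bestSet μ G C (diam2 μ F / (2 ^ k * (2 * (C + 1)))) (offspring μ (diam2 μ F) (2 * (C + 1)) T
        (k + 2) (sieve μ (diam2 μ F) C T G pick x (k + 1))) x := by
  rw [sieve]
  refine hpick.1 _ _ (bestSet_nonempty ?_)
  -- The covering property at the node itself shows that it has offspring.
  obtain ⟨v, hv, -⟩ := hT.exists_mem_offspring hF (by linarith) (by omega : 2 ≤ k + 2) hk hmem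
    (hT.level_subset (by omega) (by omega) hmem)
    (by rw [dist2_self]; exact ballRadius_nonneg (diam2_nonneg F) _)
  exact ⟨v, hv⟩

theorem IsPrunedTree.sieve_mem_level (hF : F ⊆ ambientClass μ α β) (hC : 0 < C)
    (hT : IsPrunedTree μ F (2 * (C + 1)) Jt T) (hpick : IsTieBreak pick) (x : Fin N → 𝒳) (k : ℕ)
    (hk : k + 1 ≤ Jt) : sieve μ (diam2 μ F) C T G pick x (k + 1) ∈
      level μ (diam2 μ F) (2 * (C + 1)) T (k + 1) := by
  induction k with
  | zero =>
    rw [level_one, Finset.mem_singleton, sieve]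
  | succ k ih =>
    have h := ih (by omega)
    exact (mem_level_succ (by omega)).2
      ⟨_, h, bestSet_subset (hT.sieve_succ_mem hF hC hpick x hk h)⟩

theorem IsPrunedTree.sieve_mem (hF : F ⊆ ambientClass μ α β) (hC : 0 < C)
    (hT : IsPrunedTree μ F (2 * (C + 1)) Jt T) (hpick : IsTieBreak pick) (x : Fin N → 𝒳) (k : ℕ)
    (hk : k + 1 ≤ Jt) : sieve μ (diam2 μ F) C T G pick x (k + 1) ∈ F :=
  hT.level_subset (by omega) hk (hT.sieve_mem_level hF hC hpick x k hk)

theorem IsPrunedTree.measurableSet_sieve_eq (hF : F ⊆ ambientClass μ α β) (hC : 0 < C)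
    (hT : IsPrunedTree μ F (2 * (C + 1)) Jt T) (hpick : IsTieBreak pick) (k : ℕ)
    (hk : k + 1 ≤ Jt) (q : 𝒳 → ℝ) :
    MeasurableSet {x | sieve μ (diam2 μ F) C T G pick x (k + 1) = q} := by
  induction k generalizing q with
  | zero =>
    simp only [sieve]
    exact MeasurableSet.const _
  | succ k ih =>
    simp only [sieve]
    refine measurableSet_of_finite_fibres
      (h := fun x => sieve μ (diam2 μ F) C T G pick x (k + 1))
      (level μ (diam2 μ F) (2 * (C + 1)) T (k + 1))
      (fun x => hT.sieve_mem_level hF hC hpick x k (by omega))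
      (fun v _ => ih (by omega) v)
      (p := fun x v => pick x (bestSet μ G C (diam2 μ F / (2 ^ k * (2 * (C + 1))))
        (offspring μ (diam2 μ F) (2 * (C + 1)) T (k + 2) v) x) = q) fun v hv => ?_
    refine measurableSet_of_finite_fibres
      (h := fun x => bestSet μ G C (diam2 μ F / (2 ^ k * (2 * (C + 1))))
        (offspring μ (diam2 μ F) (2 * (C + 1)) T (k + 2) v) x)
      (offspring μ (diam2 μ F) (2 * (C + 1)) T (k + 2) v).powerset
      (fun x => Finset.mem_powerset.2 bestSet_subset)
      (fun A _ => measurableSet_bestSet_eq (fun g hg =>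
        (hF (hT.offspring_subset (by omega) hk hv hg)).1) A)
      (p := fun x A => pick x A = q) fun A _ => hpick.2 A q

theorem IsPrunedTree.measurable_sq_dist2_sieve (hF : F ⊆ ambientClass μ α β) (hC : 0 < C)
    (hT : IsPrunedTree μ F (2 * (C + 1)) Jt T) (hpick : IsTieBreak pick) (k : ℕ)
    (hk : k + 1 ≤ Jt) (f : 𝒳 → ℝ) :
    Measurable fun x => dist2 μ (sieve μ (diam2 μ F) C T G pick x (k + 1)) f ^ 2 := by
  intro t _
  exact measurableSet_of_finite_fibres
    (h := fun x => sieve μ (diam2 μ F) C T G pick x (k + 1))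
    (level μ (diam2 μ F) (2 * (C + 1)) T (k + 1))
    (fun x => hT.sieve_mem_level hF hC hpick x k hk)
    (fun v _ => hT.measurableSet_sieve_eq hF hC hpick k hk v)
    (p := fun _ v => dist2 μ v f ^ 2 ∈ t) fun v _ => MeasurableSet.const _

/-- Each step moves by at most twice the ball radius, deterministically. The subtracted term is the
tail of the geometric series, kept so that the induction closes. -/
theorem IsPrunedTree.dist2_sieve_le (hF : F ⊆ ambientClass μ α β) (hC : 0 < C)
    (hT : IsPrunedTree μ F (2 * (C + 1)) Jt T) (hpick : IsTieBreak pick) (x : Fin N → 𝒳)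
    (k i : ℕ) (hk : k + i + 1 ≤ Jt) :
    dist2 μ (sieve μ (diam2 μ F) C T G pick x (k + 1))
      (sieve μ (diam2 μ F) C T G pick x (k + i + 1)) ≤
      4 * (diam2 μ F / 2 ^ k) - 4 * (diam2 μ F / 2 ^ (k + i)) := by
  induction i with
  | zero => simp [dist2_self]
  | succ i ih =>
    have h1 := ih (by omega)
    have hl := hT.sieve_mem_level (G := G) hF hC hpick x (k + i) (by omega)
    have h2 := hT.dist2_offspring_le hF (by linarith : 1 ≤ 2 * (C + 1)) (by omega : 2 ≤ k + i + 2)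
      (by omega) hl (bestSet_subset (hT.sieve_succ_mem hF hC hpick x (by omega) hl))
    have h3 := dist2_triangle_of_mem (hF (hT.sieve_mem (G := G) hF hC hpick x k (by omega)))
      (hF (hT.sieve_mem (G := G) hF hC hpick x (k + i) (by omega)))
      (hF (hT.sieve_mem (G := G) hF hC hpick x (k + i + 1) (by omega)))
    have h4 : ballRadius (diam2 μ F) (k + i + 2) = diam2 μ F / 2 ^ (k + i) := rfl
    have h5 : diam2 μ F / 2 ^ (k + i) = 2 * (diam2 μ F / 2 ^ (k + (i + 1))) := by
      rw [← add_assoc, pow_succ]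
      field_simp
    rw [h4] at h2
    change dist2 μ _ (sieve μ (diam2 μ F) C T G pick x (k + i + 1 + 1)) ≤ _
    linarith

/-- Outside an event of small probability, one step of the sieve halves the distance bound. -/
theorem IsPrunedTree.exists_bad_event (hα : 0 < α) (hαβ : α < β)
    (hCc : 1 + Real.sqrt (1 / (α * cKL α β)) < C) (hF : F ⊆ ambientClass μ α β)
    (hT : IsPrunedTree μ F (2 * (C + 1)) Jt T) (hpick : IsTieBreak pick) {k : ℕ}
    (hk : k + 2 ≤ Jt) (hd : 0 < diam2 μ F) {f : 𝒳 → ℝ} (hf : f ∈ F) {M : ℕ}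
    (hM : localPacking μ F (diam2 μ F / 2 ^ k) (2 * (2 * (C + 1))) ≤ M)
    {Ω : Type*} [MeasurableSpace Ω] {P : Measure Ω} [IsProbabilityMeasure P] {ε : ℝ}
    {Xt X : Fin N → Ω → 𝒳} (hX : IsCorruptedSample μ f ε P Xt X) (hG : IsBalanced G)
    (hε : ε ≤ 1 / 3) (hm : (m : ℝ) = max (3 * ε * N) 1) :
    ∃ B : Set (Fin N → 𝒳), MeasurableSet B ∧
      (∀ x ∉ B, dist2 μ (sieve μ (diam2 μ F) C T G pick x (k + 1)) f ≤ diam2 μ F / 2 ^ k →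
        dist2 μ (sieve μ (diam2 μ F) C T G pick x (k + 2)) f ≤ diam2 μ F / 2 ^ (k + 1)) ∧
      P.real {ω | (fun i => X i ω) ∈ B} ≤ (M : ℝ) ^ 2 * (2 ^ m * Real.exp
        (-(N * (LConst α β C * (diam2 μ F / (2 ^ k * (2 * (C + 1)))) ^ 2) / 12))) := by
  classical
  have hC : 0 < C := by linarith [Real.sqrt_nonneg (1 / (α * cKL α β))]
  set d := diam2 μ F with hdd
  set c := 2 * (C + 1) with hc
  have hc0 : 0 < c := by linarith
  set δ := d / (2 ^ k * c) with hδ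
  have hδ0 : 0 < δ := by positivity
  have hδb : ballRadius d (k + 2) / c = δ := by
    exact div_div _ _ _
  -- A fixed finite set, because the tree does not depend on the data: the randomness of the path
  -- costs only a union bound over `Q`.
  set Q := (level μ d c T (k + 1)).filter fun q => dist2 μ q f ≤ d / 2 ^ k with hQ
  have hv : ∀ q ∈ Q, ∃ v ∈ offspring μ d c T (k + 2) q, dist2 μ f v ≤ δ := fun q hq => by
    rw [← hδb]
    exact hT.exists_mem_offspring hF hc0 (by omega) hk (Finset.mem_filter.1 hq).1 hf
      (Finset.mem_filter.1 hq).2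
  choose! v hvo hvδ using hv
  set S : (𝒳 → ℝ) → Finset (𝒳 → ℝ) := fun q =>
    (offspring μ d c T (k + 2) q).filter fun g => C * δ ≤ dist2 μ (v q) g with hS
  set E : (𝒳 → ℝ) → (𝒳 → ℝ) → Set (Fin N → 𝒳) := fun q g =>
    {x | (m : ℝ) / 2 ≤ (nonnegGroups G x g (v q)).card} with hE
  have hvA : ∀ q ∈ Q, v q ∈ ambientClass μ α β := fun q hq =>
    hF (hT.offspring_subset (by omega) hk (Finset.mem_filter.1 hq).1 (hvo q hq))
  have hgA : ∀ q ∈ Q, ∀ g ∈ S q, g ∈ ambientClass μ α β := fun q hq g hg =>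
    hF (hT.offspring_subset (by omega) hk (Finset.mem_filter.1 hq).1 (Finset.mem_filter.1 hg).1)
  have hQM : (Q.card : ℝ) ≤ M := by
    have := (hT.card_near_le hc0 (by omega : 2 ≤ k + 2) hk hf).trans hM
    exact_mod_cast this
  have hSM : ∀ q ∈ Q, ((S q).card : ℝ) ≤ M := fun q hq => by
    have h1 := (hT.card_offspring_le hc0 (by omega : 2 ≤ k + 2) hk (Finset.mem_filter.1 hq).1).trans
      hM
    have h2 : (offspring μ d c T (k + 2) q).card ≤ M := by exact_mod_cast h1
    exact Nat.cast_le.2 ((Finset.card_filter_le _ _).trans h2)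
  refine ⟨⋃ q ∈ Q, ⋃ g ∈ S q, E q g, ?_, fun x hx hnear => ?_, ?_⟩
  · exact Q.measurableSet_biUnion fun q hq => (S q).measurableSet_biUnion fun g hg =>
      measurableSet_le measurable_const
        (measurable_card_nonnegGroups (hgA q hq g hg).1 (hvA q hq).1)
  · set q := sieve μ d C T G pick x (k + 1) with hq
    have hl : q ∈ level μ d c T (k + 1) := hT.sieve_mem_level hF hC hpick x k (by omega)
    have hqQ : q ∈ Q := Finset.mem_filter.2 ⟨hl, hnear⟩
    have hbest := hT.sieve_succ_mem (G := G) hF hC hpick x hk hl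
    have h1 := dist2_lt_of_mem_bestSet (mul_pos hC hδ0) (hvo q hqQ) hbest fun g hg hgd => by
      by_contra! hcon
      refine hx (Set.mem_biUnion (Finset.mem_coe.2 hqQ) ?_)
      exact Set.mem_biUnion (Finset.mem_coe.2 (Finset.mem_filter.2 ⟨hg, hgd⟩)) hcon
    have h2 := dist2_triangle_of_mem (hF hf) (hvA q hqQ)
      (hF (hT.sieve_mem (G := G) hF hC hpick x (k + 1) hk))
    -- The choice `c = 2 * (C + 1)` makes the new radius exactly half of the old one.
    have h3 : δ + C * δ = d / 2 ^ (k + 1) := by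
      rw [hδ, hc, pow_succ]
      field_simp
      ring
    rw [dist2_comm _ f, ← h3]
    have h4 := hvδ q hqQ
    change dist2 μ f (sieve μ d C T G pick x (k + 1 + 1)) ≤ _
    change dist2 μ (v q) (sieve μ d C T G pick x (k + 1 + 1)) < _ at h1
    linarith
  · have hpre : {ω | (fun i => X i ω) ∈ ⋃ q ∈ Q, ⋃ g ∈ S q, E q g} =
        ⋃ q ∈ Q, ⋃ g ∈ S q, {ω | (fun i => X i ω) ∈ E q g} := by
      ext ω
      simp
    rw [hpre]
    set b := 2 ^ m * Real.exp (-(N * (LConst α β C * δ ^ 2) / 12)) with hb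
    have hb0 : 0 ≤ b := by positivity
    calc P.real (⋃ q ∈ Q, ⋃ g ∈ S q, {ω | (fun i => X i ω) ∈ E q g})
        ≤ ∑ q ∈ Q, P.real (⋃ g ∈ S q, {ω | (fun i => X i ω) ∈ E q g}) :=
          measureReal_biUnion_finset_le _ _
      _ ≤ ∑ q ∈ Q, (M : ℝ) * b := by
          refine Finset.sum_le_sum fun q hq => ?_
          refine (measureReal_biUnion_finset_le _ _).trans ?_
          refine (Finset.sum_le_card_nsmul (S q) _ b fun g hg => ?_).trans ?_
          · exact measureReal_le_card_nonnegGroups_le hα hαβ hCc (hF hf) (hvA q hq)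
              (hgA q hq g hg) hδ0 (hvδ q hq) (Finset.mem_filter.1 hg).2 hX hG hε hm
          · rw [nsmul_eq_mul]
            exact mul_le_mul_of_nonneg_right (hSM q hq) hb0
      _ = Q.card * (M * b) := by rw [Finset.sum_const, nsmul_eq_mul]
      _ ≤ M * (M * b) := by gcongr
      _ = (M : ℝ) ^ 2 * b := by ring

end Sieve

/-! ### Unpacking the entropy condition -/

section Entropy

variable {𝒳 : Type*} [MeasurableSpace 𝒳] {μ : Measure 𝒳} {F : Set (𝒳 → ℝ)} {α β C φ : ℝ}

theorem sq_tau_succ (hC10 : 0 < C10 α β C φ) (d : ℝ) (k : ℕ) :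
    tau α β C φ d (k + 1) ^ 2 = C10 α β C φ * (d / 2 ^ k / (C + 1)) ^ 2 := by
  rw [tau, Nat.add_sub_cancel, mul_div_assoc, mul_pow, Real.sq_sqrt hC10.le, div_div]

theorem tau_succ_mul_div (hC10 : 0 < C10 α β C φ) (hC : 0 < C + 1) (d : ℝ) (k : ℕ) :
    tau α β C φ d (k + 1) * (2 * (C + 1)) / Real.sqrt (C10 α β C φ) = 2 * (d / 2 ^ k) := by
  have := Real.sqrt_pos.2 hC10
  rw [tau, Nat.add_sub_cancel]
  field_simp

theorem EntropyCondition.exists_card (hC10 : 0 < C10 α β C φ) (hC : 0 < C + 1) {N k : ℕ}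
    (h : EntropyCondition μ F α β C φ N (k + 1)) :
    Real.log 2 < N * tau α β C φ (diam2 μ F) (k + 1) ^ 2 ∧
    ∃ M : ℕ, localPacking μ F (2 * (diam2 μ F / 2 ^ k)) (2 * (2 * (C + 1))) ≤ M ∧
      (M : ℝ) ^ 2 ≤ Real.exp (N * tau α β C φ (diam2 μ F) (k + 1) ^ 2 / 2) := by
  rw [EntropyCondition, tau_succ_mul_div hC10 hC, max_lt_iff] at h
  obtain ⟨h1, h2⟩ := h
  refine ⟨EReal.coe_lt_coe_iff.1 h2, ?_⟩
  rcases hl : localPacking μ F (2 * (diam2 μ F / 2 ^ k)) (2 * (2 * (C + 1))) with _ | M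
  · exfalso
    rw [hl] at h1
    change 2 * ENNReal.log (((⊤ : ℕ∞) : ℝ≥0∞) ^ 2) < _ at h1
    rw [ENat.toENNReal_top, ENNReal.top_pow two_ne_zero, ENNReal.log_top,
      EReal.mul_top_of_pos (by norm_num)] at h1
    exact not_top_lt h1
  · refine ⟨M, le_rfl, ?_⟩
    rw [hl] at h1
    change 2 * ENNReal.log (((M : ℕ∞) : ℝ≥0∞) ^ 2) < _ at h1
    -- For `M = 0` the extended logarithm is `⊥`, and the bound is trivial.
    rcases Nat.eq_zero_or_pos M with rfl | hM
    · simp [Real.exp_nonneg]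
    · have hM0 : (0 : ℝ) < M := Nat.cast_pos.2 hM
      have h3 : ENNReal.log (((M : ℕ∞) : ℝ≥0∞) ^ 2) = ((Real.log ((M : ℝ) ^ 2) : ℝ) : EReal) := by
        rw [← ENNReal.log_ofReal_of_pos (by positivity), ENNReal.ofReal_pow hM0.le,
          ENNReal.ofReal_natCast, ENat.toENNReal_coe]
      rw [h3, show (2 : EReal) = ((2 : ℝ) : EReal) from rfl, ← EReal.coe_mul, EReal.coe_lt_coe_iff] at h1
      rw [← Real.exp_log (by positivity : (0 : ℝ) < (M : ℝ) ^ 2)]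
      exact Real.exp_le_exp.2 (by linarith)

end Entropy

/-! ### Summing the error probabilities -/

section Numerics

/-- Entropy uses at most `L / 48` of the exponent, and `m ≤ 3 ε N + 1` makes the sets of groups use
at most `L / 32`; the balance is `1 / 12 - 1 / 48 - 1 / 32 = 1 / 32`. -/
theorem sq_mul_two_pow_mul_exp_le {M L c₀ ε δ : ℝ} {N m : ℕ} (hc₀ : c₀ ≤ L / 24)
    (hM : M ^ 2 ≤ Real.exp (N * (c₀ * δ ^ 2) / 2)) (hε0 : 0 ≤ ε) (hε : ε ≤ L / 96 * δ ^ 2)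
    (hm : (m : ℝ) = max (3 * ε * N) 1) :
    M ^ 2 * (2 ^ m * Real.exp (-(N * (L * δ ^ 2) / 12))) ≤
      2 * Real.exp (-(L / 32 * N * δ ^ 2)) := by
  have hN : (0 : ℝ) ≤ N := Nat.cast_nonneg N
  have h1 : (2 : ℝ) ^ m ≤ 2 * Real.exp (3 * ε * N) := by
    have hlog : Real.log 2 ≤ 1 := by linarith [Real.log_two_lt_d9]
    have hlog0 : 0 ≤ Real.log 2 := Real.log_nonneg one_le_two
    have hm' : (m : ℝ) ≤ 3 * ε * N + 1 := by
      rw [hm]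
      have : 0 ≤ 3 * ε * N := by positivity
      exact max_le (by linarith) (by linarith)
    have h0 : (2 : ℝ) ^ m = Real.exp (m * Real.log 2) := by
      rw [Real.exp_nat_mul, Real.exp_log two_pos]
    have h2 : (2 : ℝ) * Real.exp (3 * ε * N) = Real.exp (Real.log 2 + 3 * ε * N) := by
      rw [Real.exp_add, Real.exp_log two_pos]
    rw [h0, h2, Real.exp_le_exp]
    have : 0 ≤ 3 * ε * N := by positivity
    nlinarith
  calc M ^ 2 * (2 ^ m * Real.exp (-(N * (L * δ ^ 2) / 12)))
      ≤ Real.exp (N * (c₀ * δ ^ 2) / 2) *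
          (2 * Real.exp (3 * ε * N) * Real.exp (-(N * (L * δ ^ 2) / 12))) := by gcongr
    _ = 2 * Real.exp (N * (c₀ * δ ^ 2) / 2 + 3 * ε * N + -(N * (L * δ ^ 2) / 12)) := by
        rw [Real.exp_add, Real.exp_add]
        ring
    _ ≤ 2 * Real.exp (-(L / 32 * N * δ ^ 2)) := by
        gcongr
        have h2 : (N : ℝ) * (c₀ * δ ^ 2) ≤ N * (L / 24 * δ ^ 2) := by gcongr
        have h3 : ε * N ≤ L / 96 * δ ^ 2 * N := by gcongr
        linarith

theorem sum_four_pow_le (n : ℕ) : ∑ k ∈ Finset.range n, (4 : ℝ) ^ k ≤ 4 ^ n := by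
  induction n with
  | zero => simp
  | succ n ih =>
    rw [Finset.sum_range_succ, pow_succ]
    have : (0 : ℝ) ≤ 4 ^ n := by positivity
    linarith

theorem exp_neg_le_two_div_sq {x : ℝ} (hx : 0 < x) : Real.exp (-x) ≤ 2 / x ^ 2 := by
  rw [Real.exp_neg, ← one_div, div_le_div_iff₀ (Real.exp_pos x) (by positivity)]
  have := Real.quadratic_le_exp_of_nonneg hx.le
  linarith

/-- With `y = 4 ^ (k₀ - k)`, the squared radius grows like `y`, while `exp (-x) ≤ 2 / x ^ 2` gains
`1 / y ^ 2`. The terms therefore decay like `1 / y`; the bound `1 / x` would leave a factor `k₀`. -/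
theorem sum_sq_mul_exp_le {a b d n : ℝ} (ha : 0 < a) (hb : 0 < b) (k₀ : ℕ)
    (hn : b ≤ n * (d / 2 ^ k₀) ^ 2) :
    ∑ k ∈ Finset.range k₀, 25 * (d / 2 ^ k) ^ 2 * (2 * Real.exp (-(a * n * (d / 2 ^ k) ^ 2))) ≤
      100 / (a * b) ^ 2 * (d / 2 ^ k₀) ^ 2 := by
  have hterm : ∀ k ∈ Finset.range k₀,
      25 * (d / 2 ^ k) ^ 2 * (2 * Real.exp (-(a * n * (d / 2 ^ k) ^ 2))) ≤
        100 / (a * b) ^ 2 * (d / 2 ^ k₀) ^ 2 / 4 ^ k₀ * 4 ^ k := by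
    intro k hk
    have hk' : k < k₀ := Finset.mem_range.1 hk
    set y : ℝ := 4 ^ (k₀ - k) with hy
    have hy0 : 0 < y := by positivity
    have hyk : y * 4 ^ k = 4 ^ k₀ := by
      rw [hy, ← pow_add]
      congr 1
      omega
    have h4 : ∀ i : ℕ, ((2 : ℝ) ^ i) ^ 2 = 4 ^ i := fun i => by
      rw [← pow_mul, mul_comm, pow_mul]
      norm_num
    have hR : (d / 2 ^ k) ^ 2 = y * (d / 2 ^ k₀) ^ 2 := by
      rw [div_pow, div_pow, h4, h4, ← hyk]
      field_simp
    have hx : a * b * y ≤ a * n * (d / 2 ^ k) ^ 2 := by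
      rw [hR]
      have := mul_le_mul_of_nonneg_left hn (mul_pos ha hy0).le
      linarith
    have hexp : Real.exp (-(a * n * (d / 2 ^ k) ^ 2)) ≤ 2 / (a * b * y) ^ 2 :=
      (Real.exp_le_exp.2 (neg_le_neg hx)).trans (exp_neg_le_two_div_sq (by positivity))
    calc 25 * (d / 2 ^ k) ^ 2 * (2 * Real.exp (-(a * n * (d / 2 ^ k) ^ 2)))
        ≤ 25 * (d / 2 ^ k) ^ 2 * (2 * (2 / (a * b * y) ^ 2)) := by gcongr
      _ = 100 / (a * b) ^ 2 * (d / 2 ^ k₀) ^ 2 / 4 ^ k₀ * 4 ^ k := by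
        rw [hR, ← hyk]
        field_simp
        ring
  refine (Finset.sum_le_sum hterm).trans ?_
  rw [← Finset.mul_sum]
  refine (mul_le_mul_of_nonneg_left (sum_four_pow_le k₀) (by positivity)).trans (le_of_eq ?_)
  rw [div_mul_cancel₀ _ (by positivity)]

end Numerics

/-! ### Risk bounds for the sieve -/

section Risk

variable {𝒳 : Type*} [MeasurableSpace 𝒳] {μ : Measure 𝒳} [IsProbabilityMeasure μ] {α β : ℝ}
  {F : Set (𝒳 → ℝ)} {N m : ℕ} {G : Fin N → Fin m} {C : ℝ} {Jt : ℕ} {T : TreeChoices 𝒳}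
  {pick : (Fin N → 𝒳) → Finset (𝒳 → ℝ) → (𝒳 → ℝ)} {f : 𝒳 → ℝ}
  {Ω : Type*} [MeasurableSpace Ω] {P : Measure Ω} [IsProbabilityMeasure P] {X : Fin N → Ω → 𝒳}

theorem IsPrunedTree.sq_dist2_sieve_le_sq_diam2 (hF : F ⊆ ambientClass μ α β) (hC : 0 < C)
    (hT : IsPrunedTree μ F (2 * (C + 1)) Jt T) (hpick : IsTieBreak pick) (hJ : 1 ≤ Jt)
    (hf : f ∈ F) (x : Fin N → 𝒳) :
    dist2 μ (sieve μ (diam2 μ F) C T G pick x Jt) f ^ 2 ≤ diam2 μ F ^ 2 := by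
  obtain ⟨k, rfl⟩ := Nat.exists_eq_add_of_le' hJ
  exact pow_le_pow_left₀ (dist2_nonneg _ _)
    (dist2_le_diam2 hF (hT.sieve_mem hF hC hpick x k le_rfl) hf) 2

theorem IsPrunedTree.integrable_sq_dist2_sieve (hF : F ⊆ ambientClass μ α β) (hC : 0 < C)
    (hT : IsPrunedTree μ F (2 * (C + 1)) Jt T) (hpick : IsTieBreak pick) (hJ : 1 ≤ Jt)
    (hf : f ∈ F) (hX : ∀ i, Measurable (X i)) :
    Integrable (fun ω =>
      dist2 μ (sieve μ (diam2 μ F) C T G pick (fun i => X i ω) Jt) f ^ 2) P := by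
  have hm : Measurable fun x => dist2 μ (sieve μ (diam2 μ F) C T G pick x Jt) f ^ 2 := by
    obtain ⟨k, rfl⟩ := Nat.exists_eq_add_of_le' hJ
    exact hT.measurable_sq_dist2_sieve hF hC hpick k le_rfl f
  refine Integrable.of_bound (hm.comp (measurable_pi_lambda _ hX)).aestronglyMeasurable
    (diam2 μ F ^ 2) (Filter.Eventually.of_forall fun ω => ?_)
  rw [Real.norm_eq_abs, abs_of_nonneg (sq_nonneg _)]
  exact hT.sq_dist2_sieve_le_sq_diam2 hF hC hpick hJ hf _

theorem IsPrunedTree.dist2_sieve_le_five_mul (hF : F ⊆ ambientClass μ α β) (hC : 0 < C)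
    (hT : IsPrunedTree μ F (2 * (C + 1)) Jt T) (hpick : IsTieBreak pick) (hf : f ∈ F)
    (x : Fin N → 𝒳) {k : ℕ} (hk : k + 1 ≤ Jt)
    (hnear : dist2 μ (sieve μ (diam2 μ F) C T G pick x (k + 1)) f ≤ diam2 μ F / 2 ^ k) :
    dist2 μ (sieve μ (diam2 μ F) C T G pick x Jt) f ^ 2 ≤ 25 * (diam2 μ F / 2 ^ k) ^ 2 := by
  obtain ⟨i, rfl⟩ : ∃ i, Jt = k + i + 1 := ⟨Jt - (k + 1), by omega⟩
  have h1 := hT.dist2_sieve_le (G := G) hF hC hpick x k i le_rfl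
  have h2 := dist2_triangle_of_mem (hF (hT.sieve_mem (G := G) hF hC hpick x (k + i) le_rfl))
    (hF (hT.sieve_mem (G := G) hF hC hpick x k hk)) (hF hf)
  rw [dist2_comm (sieve μ (diam2 μ F) C T G pick x (k + i + 1))
    (sieve μ (diam2 μ F) C T G pick x (k + 1))] at h2
  have h3 : 0 ≤ diam2 μ F / 2 ^ (k + i) := div_nonneg (diam2_nonneg F) (by positivity)
  have h4 : dist2 μ (sieve μ (diam2 μ F) C T G pick x (k + i + 1)) f ≤
      5 * (diam2 μ F / 2 ^ k) := by linarith
  refine (pow_le_pow_left₀ (dist2_nonneg _ _) h4 2).trans (le_of_eq ?_)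
  ring

/-- Either the invariant survives down to `k₀`, or some bad event `B k` occurs while the path is
still within `d / 2 ^ k` of `f`; in both cases `IsPrunedTree.dist2_sieve_le_five_mul` bounds the
final error at that scale. -/
theorem IsPrunedTree.integral_sq_dist2_sieve_le_sum (hF : F ⊆ ambientClass μ α β) (hC : 0 < C)
    (hT : IsPrunedTree μ F (2 * (C + 1)) Jt T) (hpick : IsTieBreak pick)
    (hf : f ∈ F) (hX : ∀ i, Measurable (X i)) {k₀ : ℕ} (hk₀ : k₀ + 1 ≤ Jt)
    (B : ℕ → Set (Fin N → 𝒳)) (hB : ∀ k < k₀, MeasurableSet (B k))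
    (hstep : ∀ k < k₀, ∀ x ∉ B k,
      dist2 μ (sieve μ (diam2 μ F) C T G pick x (k + 1)) f ≤ diam2 μ F / 2 ^ k →
        dist2 μ (sieve μ (diam2 μ F) C T G pick x (k + 2)) f ≤ diam2 μ F / 2 ^ (k + 1)) :
    ∫ ω, dist2 μ (sieve μ (diam2 μ F) C T G pick (fun i => X i ω) Jt) f ^ 2 ∂P ≤
      25 * (diam2 μ F / 2 ^ k₀) ^ 2 + ∑ k ∈ Finset.range k₀,
        25 * (diam2 μ F / 2 ^ k) ^ 2 * P.real {ω | (fun i => X i ω) ∈ B k} := by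
  have hXm : Measurable fun ω i => X i ω := measurable_pi_lambda _ hX
  set E : ℕ → Set Ω := fun k => {ω | (fun i => X i ω) ∈ B k} with hE
  have hEm : ∀ k < k₀, MeasurableSet (E k) := fun k hk => hXm (hB k hk)
  have hcase : ∀ x, ∀ n ≤ k₀,
      dist2 μ (sieve μ (diam2 μ F) C T G pick x (n + 1)) f ≤ diam2 μ F / 2 ^ n ∨
      ∃ k < n, x ∈ B k ∧
        dist2 μ (sieve μ (diam2 μ F) C T G pick x (k + 1)) f ≤ diam2 μ F / 2 ^ k := by
    intro x n hn
    induction n with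
    | zero =>
      left
      rw [pow_zero, div_one]
      exact dist2_le_diam2 hF (hT.sieve_mem hF hC hpick x 0 (by omega)) hf
    | succ n ih =>
      rcases ih (by omega) with h | ⟨k, hk, h⟩
      · by_cases hx : x ∈ B n
        · exact Or.inr ⟨n, by omega, hx, h⟩
        · exact Or.inl (hstep n (by omega) x hx h)
      · exact Or.inr ⟨k, by omega, h⟩
  have hpt : ∀ ω, dist2 μ (sieve μ (diam2 μ F) C T G pick (fun i => X i ω) Jt) f ^ 2 ≤
      25 * (diam2 μ F / 2 ^ k₀) ^ 2 + ∑ k ∈ Finset.range k₀,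
        (E k).indicator (fun _ => 25 * (diam2 μ F / 2 ^ k) ^ 2) ω := by
    intro ω
    have hnn : ∀ k ∈ Finset.range k₀,
        0 ≤ (E k).indicator (fun _ => 25 * (diam2 μ F / 2 ^ k) ^ 2) ω := fun k _ =>
      Set.indicator_nonneg (fun _ _ => by positivity) ω
    rcases hcase (fun i => X i ω) k₀ le_rfl with h | ⟨k, hk, hx, h⟩
    · have h1 := hT.dist2_sieve_le_five_mul hF hC hpick hf _ hk₀ h
      have h2 := Finset.sum_nonneg hnn
      linarith
    · have h1 := hT.dist2_sieve_le_five_mul hF hC hpick hf _ (by omega) h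
      have h2 := Finset.single_le_sum hnn (Finset.mem_range.2 hk)
      rw [Set.indicator_of_mem (show ω ∈ E k from hx)] at h2
      have h3 : 0 ≤ 25 * (diam2 μ F / 2 ^ k₀) ^ 2 := by positivity
      linarith
  have hint : ∀ k ∈ Finset.range k₀,
      Integrable ((E k).indicator fun _ => 25 * (diam2 μ F / 2 ^ k) ^ 2) P := fun k hk =>
    (integrable_const _).indicator (hEm k (Finset.mem_range.1 hk))
  calc ∫ ω, dist2 μ (sieve μ (diam2 μ F) C T G pick (fun i => X i ω) Jt) f ^ 2 ∂P
      ≤ ∫ ω, (25 * (diam2 μ F / 2 ^ k₀) ^ 2 + ∑ k ∈ Finset.range k₀,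
        (E k).indicator (fun _ => 25 * (diam2 μ F / 2 ^ k) ^ 2) ω) ∂P :=
        integral_mono (hT.integrable_sq_dist2_sieve hF hC hpick (by omega) hf hX)
          ((integrable_const _).add (integrable_finsetSum _ hint)) hpt
    _ = _ := by
        rw [integral_add (integrable_const _) (integrable_finsetSum _ hint),
          integral_finsetSum _ hint]
        refine congrArg₂ (· + ·) (by simp) (Finset.sum_congr rfl fun k hk => ?_)
        rw [integral_indicator_const _ (hEm k (Finset.mem_range.1 hk)), smul_eq_mul, mul_comm]

variable {φ ε : ℝ} {Xt : Fin N → Ω → 𝒳} {f₀ : 𝒳 → ℝ}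

/-- The risk bound at every scale down to which the entropy condition holds and which dominates the
contamination level. -/
theorem IsPrunedTree.integral_sq_dist2_sieve_le (hα : 0 < α) (hαβ : α < β)
    (hCc : 1 + Real.sqrt (1 / (α * cKL α β)) < C) (hφ1 : 1 < φ) (hφ2 : φ < 3 / 2)
    (hF : F ⊆ ambientClass μ α β) (hstar : StarConvex ℝ f₀ F)
    (hT : IsPrunedTree μ F (2 * (C + 1)) Jt T) (hpick : IsTieBreak pick) (hf : f ∈ F)
    (hX : IsCorruptedSample μ f ε P Xt X) (hG : IsBalanced G) (hε0 : 0 ≤ ε) (hε : ε ≤ 1 / 3)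
    (hm : (m : ℝ) = max (3 * ε * N) 1) {k₁ k₀ : ℕ} (hk : k₀ ≤ k₁) (hk₁ : k₁ + 1 ≤ Jt)
    (hent : EntropyCondition μ F α β C φ N (k₁ + 1))
    (hεk : ε ≤ LConst α β C / 96 * (diam2 μ F / 2 ^ k₀ / (C + 1)) ^ 2) :
    ∫ ω, dist2 μ (sieve μ (diam2 μ F) C T G pick (fun i => X i ω) Jt) f ^ 2 ∂P ≤
      (25 + 100 / (LConst α β C / (32 * (2 * (C + 1)) ^ 2) *
        (Real.log 2 * (C + 1) ^ 2 / C10 α β C φ)) ^ 2) * (diam2 μ F / 2 ^ k₀) ^ 2 := by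
  have hC : 0 < C := by linarith [Real.sqrt_nonneg (1 / (α * cKL α β))]
  have hC1 : 0 < C + 1 := by linarith
  have hL := LConst_pos hα hαβ hCc
  have hC10 := C10_pos hα hαβ hCc hφ2
  have hC10L := C10_le hα hαβ hCc hφ1
  have hlog : 0 < Real.log 2 := Real.log_pos one_lt_two
  have hd0 := diam2_nonneg (μ := μ) F
  obtain ⟨hent1, M, hM1, hM2⟩ := hent.exists_card hC10 hC1
  rw [sq_tau_succ hC10] at hent1 hM2
  -- The `log 2` in the entropy condition excludes a class of diameter `0`.
  have hd : 0 < diam2 μ F := by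
    refine hd0.lt_of_ne fun h => ?_
    rw [← h] at hent1
    simp at hent1
    linarith
  have hmono : ∀ {i j : ℕ}, i ≤ j → diam2 μ F / 2 ^ j ≤ diam2 μ F / 2 ^ i := fun hij => by
    have : (2 : ℝ) ^ _ ≤ 2 ^ _ := pow_le_pow_right₀ one_le_two hij
    gcongr
  have hhalf : ∀ {i j : ℕ}, i < j → diam2 μ F / 2 ^ j / (C + 1) ≤
      diam2 μ F / (2 ^ i * (2 * (C + 1))) := fun {i j} hij => by
    have h1 := hmono (Nat.succ_le_of_lt hij)
    have h2 : diam2 μ F / (2 ^ i * (2 * (C + 1))) = diam2 μ F / 2 ^ (i + 1) / (C + 1) := by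
      rw [pow_succ]
      field_simp
    rw [h2]
    gcongr
  have hbad : ∀ k < k₀, ∃ B : Set (Fin N → 𝒳), MeasurableSet B ∧
      (∀ x ∉ B, dist2 μ (sieve μ (diam2 μ F) C T G pick x (k + 1)) f ≤ diam2 μ F / 2 ^ k →
        dist2 μ (sieve μ (diam2 μ F) C T G pick x (k + 2)) f ≤ diam2 μ F / 2 ^ (k + 1)) ∧
      P.real {ω | (fun i => X i ω) ∈ B} ≤ 2 * Real.exp
        (-(LConst α β C / (32 * (2 * (C + 1)) ^ 2) * N * (diam2 μ F / 2 ^ k) ^ 2)) := by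
    intro k hkk
    -- The entropy condition speaks of the radius `2 * (d / 2 ^ k₁)`. As `k < k₀ ≤ k₁`, the radius
    -- here is at least that, and local packing numbers decrease with the radius.
    have hMk : localPacking μ F (diam2 μ F / 2 ^ k) (2 * (2 * (C + 1))) ≤ M := by
      refine le_trans (localPacking_anti hstar (by positivity) ?_) hM1
      have h1 := hmono (show k + 1 ≤ k₁ by omega)
      have h2 : diam2 μ F / 2 ^ k = 2 * (diam2 μ F / 2 ^ (k + 1)) := by
        rw [pow_succ]
        field_simp
      linarith
    obtain ⟨B, hBm, hB1, hB2⟩ := hT.exists_bad_event hα hαβ hCc hF hpick (by omega) hd hf hMk hX hG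
      hε hm
    refine ⟨B, hBm, hB1, hB2.trans ?_⟩
    set δ := diam2 μ F / (2 ^ k * (2 * (C + 1))) with hδ
    have h1 : (diam2 μ F / 2 ^ k₁ / (C + 1)) ^ 2 ≤ δ ^ 2 :=
      pow_le_pow_left₀ (by positivity) (hhalf (by omega)) 2
    have h2 : (diam2 μ F / 2 ^ k₀ / (C + 1)) ^ 2 ≤ δ ^ 2 :=
      pow_le_pow_left₀ (by positivity) (hhalf hkk) 2
    have h3 : (M : ℝ) ^ 2 ≤ Real.exp (N * (C10 α β C φ * δ ^ 2) / 2) := by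
      refine hM2.trans (Real.exp_le_exp.2 ?_)
      gcongr
    have h4 : ε ≤ LConst α β C / 96 * δ ^ 2 := hεk.trans (by gcongr)
    refine (sq_mul_two_pow_mul_exp_le hC10L h3 hε0 h4 hm).trans (le_of_eq ?_)
    congr 3
    rw [hδ]
    field_simp
  choose! B hBm hB1 hB2 using hbad
  refine (hT.integral_sq_dist2_sieve_le_sum hF hC hpick hf hX.2.2.2.1 (by omega) B hBm hB1).trans ?_
  rw [add_mul]
  refine add_le_add_right ?_ _
  refine le_trans (Finset.sum_le_sum fun k hk => ?_) (sum_sq_mul_exp_le (n := N)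
    (by positivity) (by positivity) k₀ ?_)
  · exact mul_le_mul_of_nonneg_left (hB2 k (Finset.mem_range.1 hk)) (by positivity)
  -- The `log 2` in the entropy condition also bounds `N * (d / 2 ^ k₀) ^ 2` from below, as the
  -- summation requires.
  · rw [div_le_iff₀ hC10]
    have h1 : (diam2 μ F / 2 ^ k₁ / (C + 1)) ^ 2 * (C + 1) ^ 2 ≤ (diam2 μ F / 2 ^ k₀) ^ 2 := by
      rw [← mul_pow, div_mul_cancel₀ _ hC1.ne']
      exact pow_le_pow_left₀ (by positivity) (hmono hk) 2
    calc Real.log 2 * (C + 1) ^ 2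
        ≤ N * (C10 α β C φ * (diam2 μ F / 2 ^ k₁ / (C + 1)) ^ 2) * (C + 1) ^ 2 := by gcongr
      _ = N * C10 α β C φ * ((diam2 μ F / 2 ^ k₁ / (C + 1)) ^ 2 * (C + 1) ^ 2) := by ring
      _ ≤ N * C10 α β C φ * (diam2 μ F / 2 ^ k₀) ^ 2 := by gcongr
      _ = _ := by ring

end Risk

/-! ### Choice of the stopping scale and conclusion -/

theorem le_mul_min_max {K z t ε D : ℝ} (hK : 1 ≤ K) (hD : 0 ≤ D) (hz : z ≤ D)
    (h : z ≤ K * t ∨ z ≤ K * ε) : z ≤ K * min (max t ε) D := by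
  have hK0 : 0 ≤ K := by linarith
  rw [mul_min_of_nonneg _ _ hK0]
  refine le_min ?_ (hz.trans (le_mul_of_one_le_left hD hK))
  rcases h with h | h
  · exact h.trans (mul_le_mul_of_nonneg_left (le_max_left _ _) hK0)
  · exact h.trans (mul_le_mul_of_nonneg_left (le_max_right _ _) hK0)

theorem exists_last_of_not {p : ℕ → Prop} (n : ℕ) (h0 : p 0) :
    ∃ k ≤ n, p k ∧ (k = n ∨ ¬ p (k + 1)) := by
  induction n with
  | zero => exact ⟨0, le_rfl, h0, Or.inl rfl⟩
  | succ n ih =>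
    obtain ⟨k, hk, hpk, rfl | h⟩ := ih
    · by_cases hp : p (k + 1)
      · exact ⟨k + 1, le_rfl, hp, Or.inl rfl⟩
      · exact ⟨k, by omega, hpk, Or.inr hp⟩
    · exact ⟨k, by omega, hpk, Or.inr h⟩

end RobustSieve

theorem mainTheorem2 (α β : ℝ) (hα : 0 < α) (hαβ : α < β)
    (C : ℝ) (hC : 1 + Real.sqrt (1 / (α * cKL α β)) < C)
    (φ : ℝ) (hφ1 : 1 < φ) (hφ2 : φ < 3 / 2) :
    ∃ K : ℝ, 0 < K ∧
      ∀ (p : ℕ) (B : Set (EuclideanSpace ℝ (Fin p))) (_ : IsCompact B)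
        (μ : Measure B) [IsProbabilityMeasure μ]
        (F : Set (B → ℝ)) (_ : F ⊆ ambientClass μ α β)
        (_ : ∃ f₀ ∈ F, StarConvex ℝ f₀ F)
        (N m : ℕ) (ε : ℝ) (_ : 0 ≤ ε) (_ : ε ≤ 1 / 3)
        (_ : (m : ℝ) = max (3 * ε * N) 1)
        (G : Fin N → Fin m) (_ : IsBalanced G)
        (Jbar Jt : ℕ) (_ : IsJbar μ F α β C φ N Jbar) (_ : Jbar ≤ Jt)
        (T : TreeChoices B) (_ : IsPrunedTree μ F (2 * (C + 1)) Jt T)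
        (pick : (Fin N → B) → Finset (B → ℝ) → (B → ℝ)) (_ : IsTieBreak pick)
        (f : B → ℝ) (_ : f ∈ F)
        (Ω : Type*) [MeasurableSpace Ω] (P : Measure Ω) [IsProbabilityMeasure P]
        (Xt X : Fin N → Ω → B) (_ : IsCorruptedSample μ f ε P Xt X),
        Integrable (fun ω =>
            dist2 μ (sieve μ (diam2 μ F) C T G pick (fun i => X i ω) Jt) f ^ 2) P ∧
          ∫ ω, dist2 μ (sieve μ (diam2 μ F) C T G pick (fun i => X i ω) Jt) f ^ 2 ∂P ≤
            K * min (max (tau α β C φ (diam2 μ F) Jbar ^ 2) ε) (diam2 μ F ^ 2) := by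
  have hC0 : 0 < C := by linarith [Real.sqrt_nonneg (1 / (α * cKL α β))]
  have hC1 : 0 < C + 1 := by linarith
  have hL := LConst_pos hα hαβ hC
  have hC10 := C10_pos hα hαβ hC hφ2
  set c₀ := C10 α β C φ with hc₀
  set κ := LConst α β C / 96 with hκ
  have hκ0 : 0 < κ := by positivity
  set A := 25 + 100 / (LConst α β C / (32 * (2 * (C + 1)) ^ 2) *
    (Real.log 2 * (C + 1) ^ 2 / c₀)) ^ 2 with hA
  have hA1 : 1 ≤ A := by
    have : 0 ≤ 100 / (LConst α β C / (32 * (2 * (C + 1)) ^ 2) *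
      (Real.log 2 * (C + 1) ^ 2 / c₀)) ^ 2 := by positivity
    linarith
  -- The terms serve the trivial bound by the squared diameter, the regime governed by `tau` and the
  -- one governed by `ε`; the `4` is the squared ratio of consecutive scales.
  set K := 1 + A * ((C + 1) ^ 2 / c₀) + 4 * A * ((C + 1) ^ 2 / κ) with hK
  have hKa : A * ((C + 1) ^ 2 / c₀) ≤ K := by
    have : 0 ≤ 4 * A * ((C + 1) ^ 2 / κ) := by positivity
    linarith
  have hKb : 4 * A * ((C + 1) ^ 2 / κ) ≤ K := by
    have : 0 ≤ A * ((C + 1) ^ 2 / c₀) := by positivity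
    linarith
  have hK1 : 1 ≤ K := by
    have h1 : 0 ≤ 4 * A * ((C + 1) ^ 2 / κ) := by positivity
    have h2 : 0 ≤ A * ((C + 1) ^ 2 / c₀) := by positivity
    linarith
  refine ⟨K, by linarith, ?_⟩
  intro p B _ μ _ F hF hstar N m ε hε0 hε hm G hG Jbar Jt hJbar hJt T hT pick hpick f hf Ω _ P _
    Xt X hX
  obtain ⟨f₀, -, hstar⟩ := hstar
  have hJ1 : 1 ≤ Jbar := by
    rcases hJbar with h | h
    · exact h.1.1
    · exact h.2.ge
  obtain ⟨k₁, rfl⟩ := Nat.exists_eq_add_of_le' hJ1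
  have hint := hT.integrable_sq_dist2_sieve (P := P) (G := G) hF hC0 hpick (by omega) hf hX.2.2.2.1
  refine ⟨hint, ?_⟩
  set Z := ∫ ω, dist2 μ (sieve μ (diam2 μ F) C T G pick (fun i => X i ω) Jt) f ^ 2 ∂P with hZ
  have hZd : Z ≤ diam2 μ F ^ 2 := by
    have h := integral_mono hint (integrable_const (diam2 μ F ^ 2)) fun ω =>
      hT.sq_dist2_sieve_le_sq_diam2 (G := G) hF hC0 hpick (by omega) hf fun i => X i ω
    simpa using h
  have hscale : ∀ (a : ℝ) (k : ℕ), 0 < a → A * (diam2 μ F / 2 ^ k) ^ 2 =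
      A * ((C + 1) ^ 2 / a) * (a * (diam2 μ F / 2 ^ k / (C + 1)) ^ 2) := fun a k ha => by
    field_simp
  have hdA : diam2 μ F ^ 2 ≤ A * (diam2 μ F / 2 ^ 0) ^ 2 := by
    rw [pow_zero, div_one]
    exact le_mul_of_one_le_left (sq_nonneg _) hA1
  refine le_mul_min_max hK1 (sq_nonneg _) hZd ?_
  rw [sq_tau_succ hC10]
  have htau : ∀ k, Z ≤ A * (diam2 μ F / 2 ^ k) ^ 2 →
      Z ≤ K * (c₀ * (diam2 μ F / 2 ^ k / (C + 1)) ^ 2) := fun k h => by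
    rw [hscale c₀ k hC10] at h
    exact h.trans (mul_le_mul_of_nonneg_right hKa (by positivity))
  rcases hJbar with h | ⟨-, h⟩
  · have hent := h.1.2
    by_cases h0 : ε ≤ κ * (diam2 μ F / 2 ^ 0 / (C + 1)) ^ 2
    · obtain ⟨k, hk, hεk, hlast⟩ := exists_last_of_not
        (p := fun k => ε ≤ κ * (diam2 μ F / 2 ^ k / (C + 1)) ^ 2) k₁ h0
      have hZk : Z ≤ A * (diam2 μ F / 2 ^ k) ^ 2 :=
        hT.integral_sq_dist2_sieve_le hα hαβ hC hφ1 hφ2 hF hstar hpick hf hX hG hε0 hε hm hk hJt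
          hent hεk
      rcases hlast with rfl | hlast
      · exact Or.inl (htau k hZk)
      -- The contamination exceeds its threshold at the next scale, so the squared scale `k` is at
      -- most a multiple of `ε`.
      · right
        have h1 : κ * (diam2 μ F / 2 ^ k / (C + 1)) ^ 2 ≤ 4 * ε := by
          have h2 : (diam2 μ F / 2 ^ k / (C + 1)) ^ 2 =
              4 * (diam2 μ F / 2 ^ (k + 1) / (C + 1)) ^ 2 := by
            rw [pow_succ (2 : ℝ) k]
            field_simp
            ring
          rw [h2]
          linarith [not_le.1 hlast]
        rw [hscale κ k hκ0] at hZk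
        calc Z ≤ A * ((C + 1) ^ 2 / κ) * (4 * ε) :=
              hZk.trans (mul_le_mul_of_nonneg_left h1 (by positivity))
          _ = 4 * A * ((C + 1) ^ 2 / κ) * ε := by ring
          _ ≤ K * ε := mul_le_mul_of_nonneg_right hKb hε0
    -- Here `ε` already dominates the squared diameter, and the trivial bound suffices.
    · right
      have hZ0 := hZd.trans hdA
      rw [hscale κ 0 hκ0] at hZ0
      have h1 : 0 ≤ A * ((C + 1) ^ 2 / κ) := by positivity
      calc Z ≤ A * ((C + 1) ^ 2 / κ) * ε :=
            hZ0.trans (mul_le_mul_of_nonneg_left (not_le.1 h0).le h1)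
        _ ≤ K * ε := mul_le_mul_of_nonneg_right (by linarith) hε0
  -- With no admissible `J`, `tau` at `1` is a fixed multiple of the diameter, so the trivial bound
  -- suffices.
  · obtain rfl : k₁ = 0 := by omega
    exact Or.inl (htau 0 (hZd.trans hdA))
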